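/- Let $m,n\ge 0$ and $d\ge 1$ be integers. For $1\le i\le m+n$ put $\overline{i}=0$ if $i\le m$ and $\overline{i}=1$ if $i>m$ (in $\mathbb Z/2$). Let $\mathfrak g=\mathfrak{gl}(m|n)$ be the Lie superalgebra over $\mathbb Q$ of $(m+n)\times(m+n)$ matrices, where the matrix unit $E_{i,j}$ has degree $\overline{i}+\overline{j}$ and the bracket is the supercommutator; let $U$ be its universal enveloping superalgebra, and let $V=\mathbb Q^{m+n}$ be the natural module, with basis $v_1,\dots,v_{m+n}$, $v_i$ of degree $\overline{i}$. Let $U$ act on $V^{\otimes d}$ by the rule $x.(v\otimes w)=x.v\otimes w+(-1)^{\overline{x}\,\overline{v}}\,v\otimes x.w$ for homogeneous $x\in\mathfrak g$ and homogeneous $v$, let $\rho_d:U\to\operatorname{End}_{\mathbb Q}(V^{\otimes d})$ be the resulting homomorphism, and let the Schur superalgebra $S(m|n,d)$ be the image of $\rho_d$. Write $E_{i,j}$ also for the image of $E_{i,j}$ in $S(m|n,d)$, and put $H_i=E_{i,i}$, $x^{(k)}=x^k/k!$ and $\binom{H_i}{k}=H_i(H_i-1)\cdots(H_i-k+1)/k!$.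 Let $S(m|n,d)_{\mathbb Z}$ be the subring of $S(m|n,d)$ generated by all $E_{i,i+1}^{(k)}$ and $E_{i+1,i}^{(k)}$ ($1\le i\le m+n-1$, $k\ge 0$) and all $\binom{H_i}{k}$ ($1\le i\le m+n$, $k\ge 0$). Let $\Phi^+=\{\varepsilon_i-\varepsilon_j \mid 1\le i<j\le m+n\}$, where $\alpha=\varepsilon_i-\varepsilon_j$ has degree $\overline{i}+\overline{j}$, and put $x_\alpha=E_{i,j}$, $x_{-\alpha}=E_{j,i}$. Fix any total order on $\Phi^+$. Let $P(m|n)$ be the set of tuples $A=(A(\alpha))_{\alpha\in\Phi^+}$ of nonnegative integers with $A(\alpha)\in\{0,1\}$ for all odd $\alpha$, and for $A \in P(m|n)$ put $$e_A=\prod_{\alpha\in\Phi^+}x_\alpha^{(A(\alpha))},\qquad f_A=\prod_{\alpha\in\Phi^+}x_{-\alpha}^{(A(\alpha))},$$ the products being taken in the fixed order. For $\lambda\in\mathbb Z_{\ge0}^{m+n}$ with $\lambda_1+\dots+\lambda_{m+n}=d$ put $1_\lambda=\prod_{i}\binom{H_i}{\lambda_i}$. The content of $x_{\pm\alpha}^{(r)}$,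 $\alpha=\varepsilon_i-\varepsilon_j\in\Phi^+$, is $r\varepsilon_j$, and contents add in products, so that for $A,C\in P(m|n)$ $$\chi(e_Af_C)=\sum_{i<j}\bigl(A(\varepsilon_i-\varepsilon_j)+C(\varepsilon_i-\varepsilon_j)\bigr)\varepsilon_j ,$$ regarded as an element of $\mathbb Z_{\ge 0}^{m+n}$; let $\preceq$ be the coordinatewise order on $\mathbb Z_{\ge 0}^{m+n}$. Then the elements $e_A1_\lambda f_C$, for $A,C\in P(m|n)$ and $\lambda\in\mathbb Z_{\ge0}^{m+n}$ with $|\lambda|=d$ and $\chi(e_Af_C)\preceq\lambda$, are pairwise distinct for distinct triples $(A,\lambda,C)$, and the set $$Y=\{\,e_A1_\lambda f_C \mid A,C\in P(m|n),\ |\lambda|=d,\ \chi(e_Af_C)\preceq\lambda\,\}$$ is a $\mathbb Q$-basis of $S(m|n,d)$ and a $\mathbb Z$-basis of $S(m|n,d)_{\mathbb Z}$. -/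

import Mathlib

namespace SchurSuper

noncomputable section

/-- The parity of an index: the first `m` indices are even, the last `n` are odd. -/
def parity (m n : ℕ) (i : Fin (m + n)) : ZMod 2 := if i.val < m then 0 else 1

/-- The sign `(-1)^{ab}` of the rule of signs. -/
def sgn (a b : ZMod 2) : ℚ := (-1) ^ (a.val * b.val)

/-- The underlying vector space of `gl(m|n)`. -/
abbrev Gl (m n : ℕ) : Type := Matrix (Fin (m + n)) (Fin (m + n)) ℚ

/-- `x` is homogeneous of degree `a`: the matrix unit `E_{ij}` has degree `parity i + parity j`. -/
def IsHomog (m n : ℕ) (a : ZMod 2) (x : Gl m n) : Prop :=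
  ∀ i j, x i j ≠ 0 → parity m n i + parity m n j = a

/-- The projection of `gl(m|n)` onto its part of degree `a`. -/
def homPart (m n : ℕ) (a : ZMod 2) : Gl m n →ₗ[ℚ] Gl m n where
  toFun x := Matrix.of fun i j => if parity m n i + parity m n j = a then x i j else 0
  map_add' x y := by ext i j; by_cases h : parity m n i + parity m n j = a <;> simp [h]
  map_smul' c x := by ext i j; by_cases h : parity m n i + parity m n j = a <;> simp [h]

/-- The defining relations of the enveloping superalgebra: for homogeneous `x`, `y`,
`x y - (-1)^{|x||y|} y x = [x, y]`, where the bracket of `gl(m|n)` is the supercommutator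
of matrices. -/
inductive EnvRel (m n : ℕ) : TensorAlgebra ℚ (Gl m n) → TensorAlgebra ℚ (Gl m n) → Prop
  | bracket (a b : ZMod 2) (x y : Gl m n) (hx : IsHomog m n a x) (hy : IsHomog m n b y) :
      EnvRel m n
        (TensorAlgebra.ι ℚ x * TensorAlgebra.ι ℚ y
          - sgn a b • (TensorAlgebra.ι ℚ y * TensorAlgebra.ι ℚ x))
        (TensorAlgebra.ι ℚ (x * y - sgn a b • (y * x)))

/-- The universal enveloping superalgebra `U` of `gl(m|n)`. -/
abbrev EnvAlg (m n : ℕ) : Type := RingQuot (EnvRel m n)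

/-- The canonical map `gl(m|n) → U`. -/
def envι (m n : ℕ) : Gl m n →ₗ[ℚ] EnvAlg m n :=
  (RingQuot.mkAlgHom ℚ (EnvRel m n)).toLinearMap ∘ₗ TensorAlgebra.ι ℚ

/-- The natural module `V`, with `v_i` of degree `parity i`. -/
abbrev NatMod (m n : ℕ) : Type := Fin (m + n) → ℚ

/-- The tensor power `V^{⊗ d}`. -/
abbrev TensorPow (m n d : ℕ) : Type := PiTensorProduct ℚ (fun _ : Fin d => NatMod m n)

/-- The usual ring structure on `End(V^{⊗ d})`, named to help instance search. -/
instance endRing (m n d : ℕ) : Ring (Module.End ℚ (TensorPow m n d)) :=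
  @Module.End.instRing ℚ (TensorPow m n d) _ PiTensorProduct.instAddCommGroup
    PiTensorProduct.instModule

/-- The operator `v ↦ (-1)^{a |v|} v` on `V`: the sign picked up when an element of degree `a`
moves past `v`. -/
def signOp (m n : ℕ) (a : ZMod 2) : Module.End ℚ (NatMod m n) :=
  Matrix.toLin' (Matrix.diagonal fun i => sgn a (parity m n i))

/-- For an operator `X` on `V` of degree `a`, the operator on `V^{⊗ d}` that applies `X` in the
tensor factor `k`, with the sign from moving `X` past the factors to the left of `k`:
`v_1 ⊗ ⋯ ⊗ v_d ↦ (-1)^{a (|v_1| + ⋯ + |v_{k-1}|)} v_1 ⊗ ⋯ ⊗ X v_k ⊗ ⋯ ⊗ v_d`. -/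
def actAt (m n d : ℕ) (a : ZMod 2) (k : Fin d) :
    Module.End ℚ (NatMod m n) →ₗ[ℚ] Module.End ℚ (TensorPow m n d) :=
  (PiTensorProduct.mapMultilinear ℚ (fun _ : Fin d => NatMod m n)
    (fun _ : Fin d => NatMod m n)).toLinearMap
    (fun l => if l < k then signOp m n a else 1) k

/-- The action of `gl(m|n)` on `V^{⊗ d}` (left multiplication on `V`, extended to tensor
products by `x.(v ⊗ w) = x.v ⊗ w + (-1)^{|x||v|} v ⊗ x.w`). -/
def glAct (m n d : ℕ) : Gl m n →ₗ[ℚ] Module.End ℚ (TensorPow m n d) :=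
  ∑ a : ZMod 2, ∑ k : Fin d,
    actAt m n d a k ∘ₗ (Matrix.toLin' : Gl m n ≃ₗ[ℚ] _).toLinearMap ∘ₗ homPart m n a

theorem homPart_self {m n : ℕ} {a : ZMod 2} {x : Gl m n} (hx : IsHomog m n a x) :
    homPart m n a x = x := by
  ext i j
  by_cases h : parity m n i + parity m n j = a
  · simp [homPart, h]
  · have : x i j = 0 := by
      by_contra h0
      exact h (hx i j h0)
    simp [homPart, h, this]

theorem homPart_ne {m n : ℕ} {a b : ZMod 2} {x : Gl m n} (hx : IsHomog m n a x) (hb : b ≠ a) :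
    homPart m n b x = 0 := by
  ext i j
  by_cases h : parity m n i + parity m n j = b
  · have : x i j = 0 := by
      by_contra h0
      exact hb (h.symm.trans (hx i j h0))
    simp [homPart, this]
  · simp [homPart, h]

theorem glAct_homog {m n : ℕ} (d : ℕ) {a : ZMod 2} {x : Gl m n} (hx : IsHomog m n a x) :
    glAct m n d x = ∑ k : Fin d, actAt m n d a k (Matrix.toLin' x) := by
  simp only [glAct, LinearMap.sum_apply, LinearMap.comp_apply]
  rw [Finset.sum_eq_single a]
  · simp [homPart_self hx]
  · intro b _ hb
    simp [homPart_ne hx hb]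
  · simp

theorem sgn_add_left (a b c : ZMod 2) : sgn (a + b) c = sgn a c * sgn b c := by
  have key : ∀ a b c : ZMod 2, ((a + b).val * c.val) % 2 = (a.val * c.val + b.val * c.val) % 2 := by
    decide
  unfold sgn
  rw [← pow_add, neg_one_pow_eq_pow_mod_two, key, ← neg_one_pow_eq_pow_mod_two]

theorem sgn_comm (a b : ZMod 2) : sgn a b = sgn b a := by
  unfold sgn
  rw [mul_comm]

theorem sgn_mul_self (a b : ZMod 2) : sgn a b * sgn a b = 1 := by
  unfold sgn
  rw [← mul_pow]
  norm_num

theorem signOp_mul (m n : ℕ) (a b : ZMod 2) :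
    signOp m n a * signOp m n b = signOp m n (a + b) := by
  unfold signOp
  rw [Module.End.mul_eq_comp, ← Matrix.toLin'_mul, Matrix.diagonal_mul_diagonal]
  simp only [sgn_add_left]

theorem signOp_mul_toLin {m n : ℕ} (a : ZMod 2) {b : ZMod 2} {y : Gl m n}
    (hy : IsHomog m n b y) :
    signOp m n a * Matrix.toLin' y = sgn a b • (Matrix.toLin' y * signOp m n a) := by
  unfold signOp
  rw [Module.End.mul_eq_comp, Module.End.mul_eq_comp, ← Matrix.toLin'_mul, ← Matrix.toLin'_mul,
    ← map_smul]
  congr 1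
  ext i j
  rw [Matrix.diagonal_mul, Matrix.smul_apply, Matrix.mul_diagonal, smul_eq_mul]
  by_cases h0 : y i j = 0
  · simp [h0]
  · have h := hy i j h0
    rw [← h, sgn_comm a (_ + _), sgn_add_left, sgn_comm a (parity m n i), sgn_comm a (parity m n j)]
    linear_combination (-sgn (parity m n i) a * y i j) * sgn_mul_self (parity m n j) a

theorem actAt_mul_same (m n d : ℕ) (a b : ZMod 2) (k : Fin d) (X Y : Module.End ℚ (NatMod m n)) :
    actAt m n d a k X * actAt m n d b k Y = actAt m n d (a + b) k (X * Y) := by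
  simp only [actAt, MultilinearMap.toLinearMap_apply, PiTensorProduct.mapMultilinear_apply]
  rw [← PiTensorProduct.map_mul]
  congr 1
  funext l
  by_cases hl : l = k
  · subst hl; simp
  · by_cases hlk : l < k
    · simp [hl, hlk, signOp_mul]
    · simp [hl, hlk]

theorem map_smul_at {m n d : ℕ} (k : Fin d) (c : ℚ)
    (f g : Fin d → Module.End ℚ (NatMod m n)) (hk : f k = c • g k)
    (h : ∀ l, l ≠ k → f l = g l) :
    PiTensorProduct.map f = c • PiTensorProduct.map g := by
  have hf : f = Function.update g k (c • g k) := by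
    funext l
    by_cases hl : l = k
    · subst hl; simp [hk]
    · simp [hl, h l hl]
  rw [hf]
  have := (PiTensorProduct.mapMultilinear ℚ (fun _ : Fin d => NatMod m n)
    (fun _ : Fin d => NatMod m n)).map_update_smul g k c (g k)
  rw [Function.update_eq_self] at this
  exact this

theorem actAt_mul_lt {m n : ℕ} (d : ℕ) {a b : ZMod 2} {k l : Fin d} (hkl : k < l) {x : Gl m n}
    (Y : Module.End ℚ (NatMod m n)) (hx : IsHomog m n a x) :
    actAt m n d b l Y * actAt m n d a k (Matrix.toLin' x) =
      sgn a b • (actAt m n d a k (Matrix.toLin' x) * actAt m n d b l Y) := by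
  simp only [actAt, MultilinearMap.toLinearMap_apply, PiTensorProduct.mapMultilinear_apply]
  rw [← PiTensorProduct.map_mul, ← PiTensorProduct.map_mul]
  apply map_smul_at k
  · simp [hkl, hkl.ne, signOp_mul_toLin b hx, sgn_comm a b]
  · intro p hp
    by_cases hpl : p = l
    · subst hpl
      simp [hp, hkl.not_gt]
    · by_cases h1 : p < k
      · simp [hp, hpl, h1, h1.trans hkl, signOp_mul, add_comm]
      · simp [hp, hpl, h1]

theorem actAt_super_comm {m n : ℕ} (d : ℕ) {a b : ZMod 2} {k l : Fin d} (hkl : k ≠ l)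
    {x y : Gl m n} (hx : IsHomog m n a x) (hy : IsHomog m n b y) :
    actAt m n d a k (Matrix.toLin' x) * actAt m n d b l (Matrix.toLin' y) =
      sgn a b • (actAt m n d b l (Matrix.toLin' y) * actAt m n d a k (Matrix.toLin' x)) := by
  rcases lt_or_gt_of_ne hkl with h | h
  · rw [actAt_mul_lt d h _ hx, smul_smul, sgn_mul_self, one_smul]
  · rw [actAt_mul_lt d h _ hy, sgn_comm]

theorem isHomog_bracket {m n : ℕ} {a b : ZMod 2} {x y : Gl m n}
    (hx : IsHomog m n a x) (hy : IsHomog m n b y) (c : ℚ) :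
    IsHomog m n (a + b) (x * y - c • (y * x)) := by
  have key : ∀ {a b : ZMod 2} {x y : Gl m n}, IsHomog m n a x → IsHomog m n b y → ∀ i j,
      parity m n i + parity m n j ≠ a + b → (x * y) i j = 0 := by
    intro a b x y hx hy i j hij
    rw [Matrix.mul_apply]
    refine Finset.sum_eq_zero fun p _ => ?_
    by_contra h0
    have h1 := hx i p (left_ne_zero_of_mul h0)
    have h2 := hy p j (right_ne_zero_of_mul h0)
    apply hij
    have h3 : parity m n p + parity m n p = 0 := CharTwo.add_self_eq_zero _
    rw [← h1, ← h2]
    linear_combination -h3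
  intro i j hne
  by_contra hij
  apply hne
  rw [Matrix.sub_apply, Matrix.smul_apply, key hx hy i j hij,
    key hy hx i j (by rwa [add_comm b a])]
  simp

theorem glAct_bracket {m n : ℕ} (d : ℕ) {a b : ZMod 2} {x y : Gl m n}
    (hx : IsHomog m n a x) (hy : IsHomog m n b y) :
    glAct m n d x * glAct m n d y - sgn a b • (glAct m n d y * glAct m n d x) =
      glAct m n d (x * y - sgn a b • (y * x)) := by
  rw [glAct_homog d hx, glAct_homog d hy, glAct_homog d (isHomog_bracket hx hy _)]
  rw [Finset.sum_mul_sum, Finset.sum_mul_sum,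
    Finset.sum_comm (f := fun i j => actAt m n d b i (Matrix.toLin' y) *
      actAt m n d a j (Matrix.toLin' x)), Finset.smul_sum, ← Finset.sum_sub_distrib]
  refine Finset.sum_congr rfl fun k _ => ?_
  rw [Finset.smul_sum, ← Finset.sum_sub_distrib, Finset.sum_eq_single k]
  · rw [actAt_mul_same, actAt_mul_same, add_comm b a, ← map_smul, ← map_sub]
    congr 1
    simp [Matrix.toLin'_mul, Module.End.mul_eq_comp]
  · intro l _ hl
    rw [actAt_super_comm d (Ne.symm hl) hx hy, sub_self]
  · simp

/-- The representation `ρ_d : U → End(V^{⊗ d})`. -/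
def rho (m n d : ℕ) : EnvAlg m n →ₐ[ℚ] Module.End ℚ (TensorPow m n d) :=
  RingQuot.liftAlgHom ℚ ⟨TensorAlgebra.lift ℚ (glAct m n d), by
    rintro _ _ ⟨a, b, x, y, hx, hy⟩
    rw [map_sub, map_smul, map_mul, map_mul, TensorAlgebra.lift_ι_apply,
      TensorAlgebra.lift_ι_apply, TensorAlgebra.lift_ι_apply]
    exact glAct_bracket d hx hy⟩

/-- The Schur superalgebra `S(m|n,d)`, the image of `ρ_d`. -/
abbrev Schur (m n d : ℕ) : Subalgebra ℚ (Module.End ℚ (TensorPow m n d)) := (rho m n d).range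

/-- The image in `S(m|n,d)` of the matrix unit `E_{ij}`. -/
def unitS (m n d : ℕ) (i j : Fin (m + n)) : Schur m n d :=
  (rho m n d).rangeRestrict (envι m n (Matrix.single i j 1))

/-- The divided power `x^{(k)} = x^k / k!`. -/
def divPow {A : Type*} [Ring A] [Algebra ℚ A] (x : A) (k : ℕ) : A :=
  (k.factorial : ℚ)⁻¹ • x ^ k

/-- The binomial `x (x - 1) ⋯ (x - k + 1) / k!`. -/
def binom {A : Type*} [Ring A] [Algebra ℚ A] (x : A) (k : ℕ) : A :=
  (k.factorial : ℚ)⁻¹ • ((List.range k).map fun t : ℕ => x - (t : A)).prod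

/-- The Kostant `ℤ`-form `S(m|n,d)_ℤ`: the subring generated by the divided powers of
`e_i = E_{i,i+1}` and `f_i = E_{i+1,i}` and by the binomials in `H_i = E_{ii}`. -/
def kostantForm (m n d : ℕ) : Subring (Schur m n d) :=
  Subring.closure
    ({x | ∃ (i j : Fin (m + n)) (k : ℕ), j.val = i.val + 1 ∧
        (x = divPow (unitS m n d i j) k ∨ x = divPow (unitS m n d j i) k)} ∪
      {x | ∃ (i : Fin (m + n)) (k : ℕ), x = binom (unitS m n d i i) k})

/-- The roots `ε_i - ε_j`, `i ≠ j`. -/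
abbrev Root (m n : ℕ) : Type := {p : Fin (m + n) × Fin (m + n) // p.1 ≠ p.2}

/-- The positive roots `ε_i - ε_j`, `i < j`. -/
abbrev PosRoot (m n : ℕ) : Type := {p : Fin (m + n) × Fin (m + n) // p.1 < p.2}

/-- A positive root `α` as a root. -/
def PosRoot.pos {m n : ℕ} (α : PosRoot m n) : Root m n := ⟨α.1, α.2.ne⟩

/-- The root `-α`. -/
def PosRoot.neg {m n : ℕ} (α : PosRoot m n) : Root m n := ⟨(α.1.2, α.1.1), α.2.ne'⟩

/-- The factors of Kostant monomials: `x_α^{(r)}` and the binomials of `H_i`. -/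
inductive KFactor (m n : ℕ) : Type
  | root (α : Root m n) (r : ℕ)
  | cartan (i : Fin (m + n)) (s : ℕ)

/-- A (formal) Kostant monomial: the product of a list of factors, in this order. -/
abbrev KMonomial (m n : ℕ) : Type := List (KFactor m n)

/-- The element of `S(m|n,d)` given by a factor. -/
def KFactor.eval {m n : ℕ} (d : ℕ) : KFactor m n → Schur m n d
  | .root α r => divPow (unitS m n d α.1.1 α.1.2) r
  | .cartan i s => binom (unitS m n d i i) s

/-- The element of `S(m|n,d)` given by a Kostant monomial. -/
def KMonomial.eval {m n : ℕ} (d : ℕ) (M : KMonomial m n) : Schur m n d :=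
  (M.map (KFactor.eval d)).prod

/-- The content of a factor: `r ε_{max(i,j)}` for `x_{ε_i - ε_j}^{(r)}`, and `0` for a binomial
of `H_i`. -/
def KFactor.content {m n : ℕ} : KFactor m n → (Fin (m + n) → ℕ)
  | .root α r => Pi.single (max α.1.1 α.1.2) r
  | .cartan _ _ => 0

/-- The content function `χ`, additive on products. -/
def KMonomial.content {m n : ℕ} (M : KMonomial m n) : Fin (m + n) → ℕ :=
  (M.map KFactor.content).sum

/-- `P(m|n)`: tuples of nonnegative integers indexed by the positive roots, with entries `0` or
`1` at the odd roots. -/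
abbrev RootTuple (m n : ℕ) : Type :=
  {A : PosRoot m n → ℕ // ∀ α : PosRoot m n,
    parity m n α.1.1 + parity m n α.1.2 = 1 → A α = 0 ∨ A α = 1}

/-- The Kostant monomial `e_A`; `ord` lists the positive roots in the chosen order. -/
def eMon {m n : ℕ} (ord : List (PosRoot m n)) (A : RootTuple m n) : KMonomial m n :=
  ord.map fun α => KFactor.root α.pos (A.1 α)

/-- The Kostant monomial `f_A`; `ord` lists the positive roots in the chosen order. -/
def fMon {m n : ℕ} (ord : List (PosRoot m n)) (A : RootTuple m n) : KMonomial m n :=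
  ord.map fun α => KFactor.root α.neg (A.1 α)

/-- The Kostant monomial `H_λ`. -/
def hMon {m n : ℕ} (lam : Fin (m + n) → ℕ) : KMonomial m n :=
  List.ofFn fun i => KFactor.cartan i (lam i)

/-- The weights `λ` of size `d`: tuples of `m + n` nonnegative integers with sum `d`. -/
abbrev Weight (m n d : ℕ) : Type := {lam : Fin (m + n) → ℕ // ∑ i, lam i = d}

/-- The triples `(A, λ, C)` with `χ(e_A f_C) ⪯ λ` (coordinatewise order). -/
abbrev Label {m n : ℕ} (d : ℕ) (ord : List (PosRoot m n)) : Type :=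
  {t : RootTuple m n × Weight m n d × RootTuple m n //
    KMonomial.content (eMon ord t.1 ++ fMon ord t.2.2) ≤ t.2.1.1}

/-- The element `e_A 1_λ f_C` of `S(m|n,d)`, where `1_λ = H_λ`. -/
def basisElt {m n d : ℕ} (ord : List (PosRoot m n)) (t : Label d ord) : Schur m n d :=
  KMonomial.eval d (eMon ord t.1.1) * KMonomial.eval d (hMon t.1.2.1.1)
    * KMonomial.eval d (fMon ord t.1.2.2)

/-- The set `Y`. -/
def setY {m n : ℕ} (d : ℕ) (ord : List (PosRoot m n)) : Set (Schur m n d) :=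
  Set.range (basisElt (d := d) ord)

end

end SchurSuper

namespace SchurSuper

noncomputable section

/-! In the tensor basis an element of `Schur m n d` is a matrix indexed by pairs of words (s, t),
and the proof is a triangularity argument for these matrices, graded by the Hamming distance of s
and t.

Leading terms: up to sign, x_α^{(r)} changes r letters in all possible ways, so e_A 1_λ f_C changes
at most |A| + |C| letters. At a pair (s, t) at distance at least |A| + |C|, no place can be changed
twice, hence at most one chain of words contributes. Its middle word lies above both s and t and
takes each letter from one of them, so it is max(s, t). The entry is therefore ±1 if A and C count
the pairs (s_k, t_k) with s_k < t_k and s_k > t_k, and λ counts the letters of max(s, t); otherwise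
it is 0 (`toMat_basisElt_sq`). Squaring removes the need to follow signs.

Such data (A, λ, C) describe one orbit of place permutations on pairs of words. The condition χ ⪯ λ
says precisely that the number of places with s_k = t_k = j, namely λ_j - χ_j, is not negative, so
every label occurs (`exists_isType`). Conversely, the algebra commutes with signed place
permutations (`toMat_mem_invariants`), so entries vanish where an odd pair of letters is repeated,
and all remaining orbits come from labels (`exists_isType_of_ne_zero`).

Independence follows by looking at a label of maximal degree. Spanning follows by removing the
entries at the largest distance and descending (`exists_eq_sum_basisElt`); since the leading entries
are ±1, integral matrices get integral coefficients. The Kostant form has integral matrices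
(`toMat_mem_int`), and it contains Y because divided powers of all root vectors are obtained from
the simple ones by an integral commutator formula (`divPow_eq_sum`). No straightening relations or
dimension counts are needed. -/

/-! ### Matrix coefficients of the matrix units -/

/-- Words of length `d`, which index the tensor basis of `V^{⊗ d}`. -/
abbrev Word (m n d : ℕ) : Type := Fin d → Fin (m + n)

/-- The tensor basis of `V^{⊗ d}`. -/
def wordBasis (m n d : ℕ) : Module.Basis (Word m n d) ℚ (TensorPow m n d) :=
  Basis.piTensorProduct fun _ => Pi.basisFun ℚ (Fin (m + n))

/-- The matrix of an element of the Schur superalgebra in the tensor basis. -/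
def toMat (m n d : ℕ) : Schur m n d →ₐ[ℚ] Matrix (Word m n d) (Word m n d) ℚ :=
  (LinearMap.toMatrixAlgEquiv (wordBasis m n d)).toAlgHom.comp (Schur m n d).val

theorem toMat_injective (m n d : ℕ) : Function.Injective (toMat m n d) :=
  (LinearMap.toMatrixAlgEquiv (wordBasis m n d)).injective.comp Subtype.val_injective

theorem unitS_val (m n d : ℕ) (i j : Fin (m + n)) :
    (unitS m n d i j : Module.End ℚ (TensorPow m n d)) = glAct m n d (Matrix.single i j 1) := by
  change rho m n d (envι m n (Matrix.single i j 1)) = _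
  simp [rho, envι]

theorem isHomog_single (m n : ℕ) (i j : Fin (m + n)) (c : ℚ) :
    IsHomog m n (parity m n i + parity m n j) (Matrix.single i j c) := by
  intro k l h
  have : i = k ∧ j = l := by
    by_contra h'
    exact h (Matrix.single_apply_of_ne _ _ _ _ _ h')
  rw [this.1, this.2]

theorem toMatrix_map {m n d : ℕ} (f : Fin d → Module.End ℚ (NatMod m n)) (s t : Word m n d) :
    LinearMap.toMatrixAlgEquiv (wordBasis m n d) (PiTensorProduct.map f) s t
      = ∏ l, f l (Pi.single (t l) 1) (s l) := by
  rw [LinearMap.toMatrixAlgEquiv_apply, wordBasis, Basis.piTensorProduct_apply,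
    PiTensorProduct.map_tprod, Basis.piTensorProduct_repr_tprod_apply]
  simp

theorem toMatrix_actAt {m n d : ℕ} (a : ZMod 2) (k : Fin d) (i j : Fin (m + n))
    (s t : Word m n d) :
    LinearMap.toMatrixAlgEquiv (wordBasis m n d)
      (actAt m n d a k (Matrix.toLin' (Matrix.single i j 1))) s t
      = if s k = i ∧ t k = j ∧ ∀ l ≠ k, s l = t l then
          ∏ l ∈ Finset.Iio k, sgn a (parity m n (t l)) else 0 := by
  simp only [actAt, MultilinearMap.toLinearMap_apply, PiTensorProduct.mapMultilinear_apply]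
  rw [toMatrix_map]
  have hsign : ∀ l, l < k → (signOp m n a (Pi.single (t l) 1)) (s l)
      = if s l = t l then sgn a (parity m n (t l)) else 0 := by
    intro l _
    by_cases h : s l = t l
    · simp [signOp, h]
    · simp [signOp, h]
  split_ifs with h
  · obtain ⟨h1, h2, h3⟩ := h
    rw [← Finset.prod_subset (Finset.subset_univ (Finset.Iio k))]
    · refine Finset.prod_congr rfl fun l hl => ?_
      have hl := Finset.mem_Iio.1 hl
      rw [Function.update_of_ne hl.ne, if_pos hl, hsign l hl, if_pos (h3 l hl.ne)]
    · intro l _ hl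
      have hl := fun h => hl (Finset.mem_Iio.2 h)
      by_cases hlk : l = k
      · subst hlk
        simp [h1, h2]
      · rw [Function.update_of_ne hlk, if_neg hl]
        simp [h3 l hlk]
  · by_cases hk : s k = i ∧ t k = j
    · have : ∃ l, l ≠ k ∧ s l ≠ t l := by
        by_contra h'
        push Not at h'
        exact h ⟨hk.1, hk.2, h'⟩
      obtain ⟨l, hlk, hl⟩ := this
      refine Finset.prod_eq_zero (Finset.mem_univ l) ?_
      rw [Function.update_of_ne hlk]
      by_cases hl' : l < k
      · rw [if_pos hl', hsign l hl', if_neg hl]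
      · rw [if_neg hl']
        simp [hl]
    · refine Finset.prod_eq_zero (Finset.mem_univ k) ?_
      rw [Function.update_self, Matrix.toLin'_apply, Matrix.mulVec_single_one,
        Matrix.col_apply]
      refine Matrix.single_apply_of_ne _ _ _ _ _ fun h' => hk ⟨h'.1.symm, h'.2.symm⟩

/-- The matrix coefficients of `E_{ij}` on `V^{⊗ d}`. -/
theorem toMat_unitS {m n d : ℕ} (i j : Fin (m + n)) (s t : Word m n d) :
    toMat m n d (unitS m n d i j) s t
      = ∑ k, if s k = i ∧ t k = j ∧ ∀ l ≠ k, s l = t l then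
          ∏ l ∈ Finset.Iio k, sgn (parity m n i + parity m n j) (parity m n (t l)) else 0 := by
  change LinearMap.toMatrixAlgEquiv (wordBasis m n d) (unitS m n d i j).1 s t = _
  rw [unitS_val, glAct_homog d (isHomog_single m n i j 1), map_sum, Matrix.sum_apply]
  exact Finset.sum_congr rfl fun k _ => toMatrix_actAt _ k i j s t

theorem toMat_binom {m n d : ℕ} (x : Schur m n d) (k : ℕ) :
    toMat m n d (binom x k) = binom (toMat m n d x) k := by
  simp only [binom, map_smul, map_list_prod, List.map_map]
  congr 3
  funext t
  simp

/-! ### Relations between matrix units -/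

/-- Bracket relations between the images of matrix units. -/
theorem unitS_bracket {m n d : ℕ} (i j k l : Fin (m + n)) :
    unitS m n d i j * unitS m n d k l
      - sgn (parity m n i + parity m n j) (parity m n k + parity m n l) •
        (unitS m n d k l * unitS m n d i j)
      = (if j = k then unitS m n d i l else 0)
        - sgn (parity m n i + parity m n j) (parity m n k + parity m n l) •
          (if l = i then unitS m n d k j else 0) := by
  apply Subtype.val_injective
  have h := glAct_bracket d (isHomog_single m n i j 1) (isHomog_single m n k l 1)
  have e : ∀ i j k l : Fin (m + n), glAct m n d (Matrix.single i j 1 * Matrix.single k l 1)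
      = ((if j = k then unitS m n d i l else 0 : Schur m n d) :
          Module.End ℚ (TensorPow m n d)) := by
    intro i j k l
    split_ifs with hjk
    · subst hjk
      rw [Matrix.single_mul_single_same, unitS_val, mul_one]
    · rw [Matrix.single_mul_single_of_ne _ _ _ _ hjk, map_zero]
      rfl
  rw [map_sub, map_smul, e, e] at h
  simp only [← unitS_val] at h
  exact h

/-- The square of an odd matrix unit vanishes. -/
theorem unitS_sq_of_odd {m n d : ℕ} {i j : Fin (m + n)} (h : parity m n i + parity m n j = 1) :
    unitS m n d i j ^ 2 = 0 := by
  have hij : j ≠ i := by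
    rintro rfl
    rw [CharTwo.add_self_eq_zero] at h
    exact zero_ne_one h
  have hs : sgn 1 1 = -1 := by
    have : (1 : ZMod 2).val = 1 := rfl
    simp [sgn, this]
  have := unitS_bracket (d := d) i j i j
  rw [h, hs, if_neg hij, smul_zero, sub_zero, neg_one_smul, sub_neg_eq_add, ← sq,
    ← two_smul ℚ, smul_eq_zero] at this
  exact this.resolve_left two_ne_zero

/-! ### Matrix coefficients of divided powers and binomials -/

/-- `s` arises from `t` by changing some letters `j` to `i`. -/
def Moves {m n d : ℕ} (i j : Fin (m + n)) (s t : Word m n d) : Prop :=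
  ∀ k, s k = t k ∨ (s k = i ∧ t k = j)

instance {m n d : ℕ} (i j : Fin (m + n)) (s t : Word m n d) : Decidable (Moves i j s t) :=
  inferInstanceAs (Decidable (∀ k, s k = t k ∨ (s k = i ∧ t k = j)))

theorem sgn_sq (a b : ZMod 2) : sgn a b ^ 2 = 1 := by
  rw [sq, sgn_mul_self]

theorem sgn_zero_left (a : ZMod 2) : sgn 0 a = 1 := by simp [sgn]

theorem hammingDist_eq_one_of {m n d : ℕ} {s t : Word m n d} {k : Fin d} (hk : s k ≠ t k)
    (h : ∀ l ≠ k, s l = t l) : hammingDist s t = 1 := by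
  rw [hammingDist, Finset.card_eq_one]
  refine ⟨k, ?_⟩
  ext l
  simp only [Finset.mem_filter, Finset.mem_univ, true_and, Finset.mem_singleton]
  constructor
  · intro hl
    by_contra hlk
    exact hl (h l hlk)
  · rintro rfl
    exact hk

/-- Only the single place where the words differ can contribute, and it contributes a product of
signs. The square forgets this sign; knowing that entries are 0 or ±1 is all that the triangularity
needs. -/
theorem toMat_unitS_sq {m n d : ℕ} {i j : Fin (m + n)} (hij : i ≠ j) (s t : Word m n d) :
    toMat m n d (unitS m n d i j) s t ^ 2
      = if Moves i j s t ∧ hammingDist s t = 1 then 1 else 0 := by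
  rw [toMat_unitS]
  split_ifs with h
  · obtain ⟨hm, h1⟩ := h
    rw [hammingDist, Finset.card_eq_one] at h1
    obtain ⟨k, hk⟩ := h1
    have hk' : ∀ l, s l ≠ t l ↔ l = k := by
      intro l
      have := congrArg (l ∈ ·) hk
      simpa using this
    have hkm := (hm k).resolve_left ((hk' k).2 rfl)
    rw [Finset.sum_eq_single k]
    · rw [if_pos ⟨hkm.1, hkm.2, fun l hl => by
        by_contra h
        exact hl ((hk' l).1 h)⟩, ← Finset.prod_pow]
      exact Finset.prod_eq_one fun l _ => sgn_sq _ _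
    · intro l _ hl
      refine if_neg fun h => (hk' k).2 rfl (h.2.2 k hl.symm)
    · simp
  · rw [Finset.sum_eq_zero, zero_pow two_ne_zero]
    intro k _
    refine if_neg fun hk => h ⟨fun l => ?_, ?_⟩
    · by_cases hl : l = k
      · subst hl
        exact Or.inr ⟨hk.1, hk.2.1⟩
      · exact Or.inl (hk.2.2 l hl)
    · refine hammingDist_eq_one_of (k := k) ?_ hk.2.2
      rw [hk.1, hk.2.1]
      exact hij

theorem divPow_succ {A : Type*} [Ring A] [Algebra ℚ A] (x : A) (r : ℕ) :
    divPow x (r + 1) = ((r : ℚ) + 1)⁻¹ • (x * divPow x r) := by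
  simp only [divPow, pow_succ', Nat.factorial_succ, Nat.cast_mul, mul_inv, mul_smul_comm,
    smul_smul]
  push_cast
  rfl

theorem divPow_zero {A : Type*} [Ring A] [Algebra ℚ A] (x : A) : divPow x 0 = 1 := by
  simp [divPow]

theorem divPow_one {A : Type*} [Ring A] [Algebra ℚ A] (x : A) : divPow x 1 = x := by
  simp [divPow]

/-- This is the counting step for divided powers: a word obtained by r + 1 changes arises from r
changes in as many ways as it has changed places k. -/
theorem moves_update_iff {m n d : ℕ} {i j : Fin (m + n)} (hij : i ≠ j) (s t : Word m n d)
    (k : Fin d) (r : ℕ) :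
    (s k = i ∧ Moves i j (Function.update s k j) t
      ∧ hammingDist (Function.update s k j) t = r)
      ↔ (s k ≠ t k ∧ Moves i j s t ∧ hammingDist s t = r + 1) := by
  have key : s k ≠ t k → t k = j →
      hammingDist s t = hammingDist (Function.update s k j) t + 1 := by
    intro h1 h2
    simp only [hammingDist]
    have : (Finset.univ.filter fun l => s l ≠ t l)
        = insert k (Finset.univ.filter fun l => Function.update s k j l ≠ t l) := by
      ext l
      by_cases hl : l = k
      · subst hl; simp [h1]
      · simp [hl]
    rw [this, Finset.card_insert_of_notMem]
    simp [h2]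
  constructor
  · rintro ⟨h1, h2, h3⟩
    have hk := h2 k
    rw [Function.update_self] at hk
    have htk : t k = j := by
      rcases hk with h | h
      · exact h.symm
      · exact h.2
    have hne : s k ≠ t k := by rw [h1, htk]; exact hij
    refine ⟨hne, fun l => ?_, by rw [key hne htk, h3]⟩
    by_cases hl : l = k
    · subst hl; exact Or.inr ⟨h1, htk⟩
    · simpa [hl] using h2 l
  · rintro ⟨h1, h2, h3⟩
    have hk := (h2 k).resolve_left h1
    refine ⟨hk.1, fun l => ?_, ?_⟩
    · by_cases hl : l = k
      · subst hl; simp [hk.2]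
      · simpa [hl] using h2 l
    · have := key h1 hk.2
      omega

theorem toMat_unitS_mul_of_even {m n d : ℕ} {i j : Fin (m + n)}
    (he : parity m n i + parity m n j = 0)
    (Y : Matrix (Word m n d) (Word m n d) ℚ) (s t : Word m n d) :
    (toMat m n d (unitS m n d i j) * Y) s t
      = ∑ k, if s k = i then Y (Function.update s k j) t else 0 := by
  rw [Matrix.mul_apply]
  simp only [toMat_unitS, he, sgn_zero_left, Finset.prod_const_one, Finset.sum_mul, ite_mul,
    one_mul, zero_mul]
  rw [Finset.sum_comm]
  refine Finset.sum_congr rfl fun k _ => ?_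
  rw [Finset.sum_eq_single (Function.update s k j)]
  · refine if_congr ?_ rfl rfl
    constructor
    · exact fun h => h.1
    · intro h
      refine ⟨h, by simp, fun l hl => by simp [hl]⟩
  · intro u _ hu
    refine if_neg fun h => hu ?_
    funext l
    by_cases hl : l = k
    · subst hl; simp [h.2.1]
    · simp [hl, h.2.2 l hl]
  · simp

theorem toMat_divPow_even {m n d : ℕ} {i j : Fin (m + n)} (hij : i ≠ j)
    (he : parity m n i + parity m n j = 0) (r : ℕ) (s t : Word m n d) :
    toMat m n d (divPow (unitS m n d i j) r) s t
      = if Moves i j s t ∧ hammingDist s t = r then 1 else 0 := by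
  induction r generalizing s with
  | zero =>
    rw [divPow_zero, map_one, Matrix.one_apply]
    refine if_congr ?_ rfl rfl
    rw [hammingDist_eq_zero]
    constructor
    · rintro rfl
      exact ⟨fun k => Or.inl rfl, rfl⟩
    · exact fun h => h.2
  | succ r ih =>
    rw [divPow_succ, map_smul, map_mul, Matrix.smul_apply, toMat_unitS_mul_of_even he]
    simp only [ih, ← ite_and, moves_update_iff hij]
    split_ifs with h
    -- The sum counts the r + 1 places where the words differ, which cancels the factor 1/(r + 1) of
    -- `divPow_succ`.
    · simp only [h, and_true, Finset.sum_boole]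
      have := h.2
      rw [hammingDist] at this
      rw [this]
      push_cast
      rw [smul_eq_mul, inv_mul_cancel₀]
      positivity
    · simp [h]

theorem divPow_odd_eq_zero {m n d : ℕ} {i j : Fin (m + n)}
    (h : parity m n i + parity m n j = 1) {r : ℕ} (hr : 2 ≤ r) :
    divPow (unitS m n d i j) r = 0 := by
  rw [divPow, ← Nat.add_sub_cancel' hr, pow_add, unitS_sq_of_odd h, zero_mul, smul_zero]

theorem zmod_two_cases (a : ZMod 2) : a = 0 ∨ a = 1 := by
  revert a; decide

/-- Up to sign, `x_α^{(r)}` changes `r` letters in all possible ways. -/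
theorem toMat_divPow_sq {m n d : ℕ} {i j : Fin (m + n)} (hij : i ≠ j) (r : ℕ)
    (hr : parity m n i + parity m n j = 1 → r = 0 ∨ r = 1) (s t : Word m n d) :
    toMat m n d (divPow (unitS m n d i j) r) s t ^ 2
      = if Moves i j s t ∧ hammingDist s t = r then 1 else 0 := by
  rcases zmod_two_cases (parity m n i + parity m n j) with h | h
  · rw [toMat_divPow_even hij h]
    split_ifs <;> simp
  · rcases hr h with rfl | rfl
    · rw [divPow_zero, map_one, Matrix.one_apply]
      have : (Moves i j s t ∧ hammingDist s t = 0) ↔ s = t := by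
        rw [hammingDist_eq_zero]
        constructor
        · exact fun h => h.2
        · rintro rfl
          exact ⟨fun k => Or.inl rfl, rfl⟩
      simp only [this]
      split_ifs <;> simp
    · rw [divPow_one, toMat_unitS_sq hij]

theorem toMat_unitS_diag {m n d : ℕ} (i : Fin (m + n)) :
    toMat m n d (unitS m n d i i)
      = Matrix.diagonal fun t => ((Finset.univ.filter fun k => t k = i).card : ℚ) := by
  ext s t
  rw [toMat_unitS, CharTwo.add_self_eq_zero]
  simp only [sgn_zero_left, Finset.prod_const_one]
  by_cases h : s = t
  · subst h
    rw [Matrix.diagonal_apply_eq]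
    simp
  · rw [Matrix.diagonal_apply_ne _ h]
    refine Finset.sum_eq_zero fun k _ => if_neg fun hk => h ?_
    funext l
    by_cases hl : l = k
    · subst hl; rw [hk.1, hk.2.1]
    · exact hk.2.2 l hl

theorem prod_range_sub_cast (c k : ℕ) :
    ((List.range k).map fun t : ℕ => (c : ℚ) - t).prod = (c.descFactorial k : ℚ) := by
  induction k with
  | zero => simp
  | succ k ih =>
    rw [List.range_succ, List.map_append, List.prod_append, ih, Nat.descFactorial_succ]
    rcases le_or_gt k c with h | h
    · push_cast [h]
      simp [mul_comm]
    · simp [Nat.descFactorial_eq_zero_iff_lt.2 h]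

theorem binom_diagonal {ι : Type*} [Fintype ι] [DecidableEq ι] (f : ι → ℕ) (k : ℕ) :
    binom (Matrix.diagonal fun t => (f t : ℚ)) k
      = Matrix.diagonal fun t => ((f t).choose k : ℚ) := by
  have h : ∀ l : List ℕ, (l.map fun t : ℕ => (Matrix.diagonal fun t => (f t : ℚ))
      - (t : Matrix ι ι ℚ)).prod
      = Matrix.diagonal fun x => (l.map fun t : ℕ => (f x : ℚ) - t).prod := by
    intro l
    induction l with
    | nil => simp
    | cons a l ih =>
      rw [List.map_cons, List.prod_cons, ih, ← Matrix.diagonal_natCast, Matrix.diagonal_sub,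
        Matrix.diagonal_mul_diagonal]
      simp
  rw [binom, h, ← Matrix.diagonal_smul]
  congr 1
  funext t
  rw [Pi.smul_apply, prod_range_sub_cast, Nat.descFactorial_eq_factorial_mul_choose]
  push_cast
  rw [smul_eq_mul, inv_mul_cancel_left₀]
  exact_mod_cast k.factorial_ne_zero

theorem toMat_cartan {m n d : ℕ} (i : Fin (m + n)) (k : ℕ) :
    toMat m n d (binom (unitS m n d i i) k)
      = Matrix.diagonal fun t =>
          (((Finset.univ.filter fun l => t l = i).card.choose k : ℕ) : ℚ) := by
  rw [toMat_binom, toMat_unitS_diag, binom_diagonal]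

theorem eq_of_le_of_sum_eq {ι : Type*} [Fintype ι] {f g : ι → ℕ} (h : ∀ i, f i ≤ g i)
    (hs : ∑ i, f i = ∑ i, g i) : f = g := by
  funext i
  exact (Finset.sum_eq_sum_iff_of_le fun i _ => h i).1 hs i (Finset.mem_univ i)

/-- `1_λ` is the projection onto the weight space of weight `λ`. -/
theorem toMat_hMon {m n d : ℕ} (lam : Weight m n d) :
    toMat m n d (KMonomial.eval d (hMon lam.1))
      = Matrix.diagonal fun t : Word m n d =>
          if ∀ i, (Finset.univ.filter fun l => t l = i).card = lam.1 i then 1 else 0 := by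
  have h : toMat m n d (KMonomial.eval d (hMon lam.1))
      = Matrix.diagonal fun t : Word m n d =>
          ∏ i, (((Finset.univ.filter fun l => t l = i).card.choose (lam.1 i) : ℕ) : ℚ) := by
    have hl : ∀ l : List (Fin (m + n)),
        toMat m n d (KMonomial.eval d (l.map fun i => KFactor.cartan i (lam.1 i)))
        = Matrix.diagonal fun t : Word m n d => (l.map fun i =>
          (((Finset.univ.filter fun l => t l = i).card.choose (lam.1 i) : ℕ) : ℚ)).prod := by
      intro l
      induction l with
      | nil => simp [KMonomial.eval]
      | cons a l ih =>
        simp only [KMonomial.eval, List.map_cons, List.prod_cons, map_mul] at ih ⊢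
        rw [ih, KFactor.eval, toMat_cartan, Matrix.diagonal_mul_diagonal]
    rw [hMon, List.ofFn_eq_map, hl]
    rfl
  rw [h]
  congr 1
  funext t
  split_ifs with ht
  · exact Finset.prod_eq_one fun i _ => by simp [ht i]
  · by_contra hne
    rw [← ne_eq, Finset.prod_ne_zero_iff] at hne
    apply ht
    -- Nonvanishing binomials give only an inequality in each coordinate; since both sides sum to d,
    -- it is an equality.
    have hle : ∀ i, lam.1 i ≤ (Finset.univ.filter fun l => t l = i).card := by
      intro i
      by_contra hi
      exact hne i (Finset.mem_univ i) (by simp [Nat.choose_eq_zero_of_lt (not_le.1 hi)])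
    have hsum : ∑ i, lam.1 i = ∑ i, (Finset.univ.filter fun l => t l = i).card := by
      rw [lam.2, ← Finset.card_eq_sum_card_fiberwise (fun _ _ => Finset.mem_coe.2
        (Finset.mem_univ _)), Finset.card_univ, Fintype.card_fin]
    exact fun i => (congrFun (eq_of_le_of_sum_eq hle hsum) i).symm

/-! ### Hamming geodesics and products of root vectors -/

/-- Equality in the triangle inequality leaves no place that is changed both between s and u and
between u and t, since such a place would be counted twice. -/
theorem eq_or_eq_of_hammingDist_add_le {m n d : ℕ} {s u t : Word m n d}
    (h : hammingDist s u + hammingDist u t ≤ hammingDist s t) (k : Fin d) :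
    s k = u k ∨ u k = t k := by
  by_contra hk
  push Not at hk
  simp only [hammingDist] at h
  rw [← Finset.card_union_add_card_inter] at h
  have h1 : (Finset.univ.filter fun l => s l ≠ t l).card
      ≤ ((Finset.univ.filter fun l => s l ≠ u l) ∪ Finset.univ.filter fun l => u l ≠ t l).card := by
    refine Finset.card_le_card fun l hl => ?_
    simp only [Finset.mem_filter, Finset.mem_univ, true_and, Finset.mem_union] at hl ⊢
    by_contra h'
    push Not at h'
    exact hl (h'.1.trans h'.2)
  have h2 : 0 < ((Finset.univ.filter fun l => s l ≠ u l)
      ∩ Finset.univ.filter fun l => u l ≠ t l).card :=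
    Finset.card_pos.2 ⟨k, by simp [hk]⟩
  omega

theorem hammingDist_add_eq_of {m n d : ℕ} {s u t : Word m n d}
    (h : ∀ k, s k = u k ∨ u k = t k) :
    hammingDist s u + hammingDist u t = hammingDist s t := by
  simp only [hammingDist]
  rw [← Finset.card_union_of_disjoint]
  · congr 1
    ext k
    simp only [Finset.mem_filter, Finset.mem_univ, true_and, Finset.mem_union]
    rcases h k with h | h <;> simp [h]
  · rw [Finset.disjoint_left]
    intro k hk
    simp only [Finset.mem_filter, Finset.mem_univ, true_and, not_not] at hk ⊢
    exact (h k).resolve_left hk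

/-- The number of places where the pair of words `(s, t)` has the pair of letters `p`. -/
def pairCount {m n d : ℕ} (s t : Word m n d) (p : Fin (m + n) × Fin (m + n)) : ℕ :=
  (Finset.univ.filter fun k => (s k, t k) = p).card

/-- The letters in which `s` and `t` differ are given by the roots `f α`, `α ∈ L`, where `f α`
occurs `A α` times. -/
def Fits {m n d : ℕ} (f : PosRoot m n → Root m n) (A : PosRoot m n → ℕ) (L : List (PosRoot m n))
    (s t : Word m n d) : Prop :=
  (∀ k, s k ≠ t k → ∃ α ∈ L, (s k, t k) = (f α).1) ∧ ∀ α ∈ L, pairCount s t (f α).1 = A α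

/-- The places where the words differ are partitioned by the pair of letters they carry, and
distinct roots give distinct pairs. -/
theorem Fits.hammingDist_eq {m n d : ℕ} {f : PosRoot m n → Root m n}
    (hf : Function.Injective f) {A : PosRoot m n → ℕ} {L : List (PosRoot m n)} (hL : L.Nodup)
    {s t : Word m n d} (h : Fits f A L s t) : hammingDist s t = (L.map A).sum := by
  classical
  have hA : L.map A = L.map fun α => pairCount s t (f α).1 :=
    List.map_congr_left fun α hα => (h.2 α hα).symm
  rw [hA, ← List.sum_toFinset _ hL]
  simp only [hammingDist, pairCount]
  rw [← Finset.card_biUnion]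
  · congr 1
    ext k
    simp only [Finset.mem_filter, Finset.mem_univ, true_and, Finset.mem_biUnion,
      List.mem_toFinset]
    constructor
    · exact h.1 k
    · rintro ⟨α, _, hα⟩ he
      exact (f α).2 (by rw [← hα]; exact he)
  · intro α _ β _ hαβ
    rw [Function.onFun, Finset.disjoint_left]
    intro k hk hk'
    simp only [Finset.mem_filter, Finset.mem_univ, true_and] at hk hk'
    exact hαβ (hf (Subtype.ext (hk.symm.trans hk')))

open scoped Classical in
/-- The leading coefficients of a product of divided powers of distinct root vectors. -/
theorem toMat_rootProd_sq {m n d : ℕ} {f : PosRoot m n → Root m n} (hf : Function.Injective f)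
    {A : PosRoot m n → ℕ}
    (hA : ∀ α, parity m n (f α).1.1 + parity m n (f α).1.2 = 1 → A α = 0 ∨ A α = 1)
    {L : List (PosRoot m n)} (hL : L.Nodup) {s t : Word m n d}
    (hst : (L.map A).sum ≤ hammingDist s t) :
    toMat m n d (KMonomial.eval d (L.map fun α => KFactor.root (f α) (A α))) s t ^ 2
      = if Fits f A L s t then 1 else 0 := by
  induction L generalizing s with
  | nil =>
    simp only [KMonomial.eval, List.map_nil, List.prod_nil, map_one, Matrix.one_apply]
    have : Fits f A [] s t ↔ s = t := by
      simp only [Fits, List.not_mem_nil, false_and, exists_false, imp_false, not_not,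
        IsEmpty.forall_iff, implies_true, and_true]
      exact funext_iff.symm
    simp only [this]
    split_ifs <;> simp
  | cons α L ih =>
    rw [List.nodup_cons] at hL
    have ih := fun s h => ih hL.2 (s := s) h
    simp only [List.map_cons, List.sum_cons] at hst
    have hX := fun u => toMat_divPow_sq (d := d) (f α).2 (A α) (hA α) s u
    have hne : ∀ β ∈ L, (f α).1 ≠ (f β).1 := by
      intro β hβ h
      exact hL.1 ((hf (Subtype.ext h)) ▸ hβ)
    set P := toMat m n d (KMonomial.eval d (L.map fun α => KFactor.root (f α) (A α))) with hP
    have hmul : toMat m n d (KMonomial.eval d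
        ((α :: L).map fun α => KFactor.root (f α) (A α))) s t
        = ∑ u, toMat m n d (divPow (unitS m n d (f α).1.1 (f α).1.2) (A α)) s u * P u t := by
      rw [← Matrix.mul_apply, hP, ← map_mul]
      rfl
    set X := toMat m n d (divPow (unitS m n d (f α).1.1 (f α).1.2) (A α)) with hXdef
    -- The only intermediate word that can contribute: the first factor makes every change of type
    -- `f α`, and the other factors make the rest.
    let u₀ : Word m n d := fun k => if (s k, t k) = (f α).1 then t k else s k
    have hu₀ : ∀ k, (s k, t k) = (f α).1 → u₀ k = t k := fun k hk => if_pos hk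
    have hu₀' : ∀ k, (s k, t k) ≠ (f α).1 → u₀ k = s k := fun k hk => if_neg hk
    -- A contributing u is at distance `A α` from s, so it is far enough from t for the induction
    -- hypothesis. This forces equality in the triangle inequality. No place with the pair `f α` can
    -- be left to the later factors, because their roots are different.
    have hzero : ∀ u, u ≠ u₀ → X s u * P u t = 0 := by
      intro u hu
      by_contra h0
      have h1 := pow_ne_zero 2 (left_ne_zero_of_mul h0)
      have h2 := pow_ne_zero 2 (right_ne_zero_of_mul h0)
      rw [hX] at h1
      have h1 : Moves (f α).1.1 (f α).1.2 s u ∧ hammingDist s u = A α := by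
        by_contra h; exact h1 (if_neg h)
      have htri := hammingDist_triangle s u t
      have h12 := h1.2
      rw [ih u (by omega)] at h2
      have h2 : Fits f A L u t := by
        by_contra h; exact h2 (if_neg h)
      have hd := h2.hammingDist_eq hf hL.2
      apply hu
      funext k
      by_cases hk : s k = u k
      · by_cases hk' : (s k, t k) = (f α).1
        · have hut : u k ≠ t k := by
            rw [← hk]
            intro h
            apply (f α).2
            rw [← hk']
            exact h
          obtain ⟨β, hβ, hβ'⟩ := h2.1 k hut
          rw [← hk] at hβ'
          exact absurd (hk'.symm.trans hβ') (hne β hβ)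
        · rw [hu₀' k hk', hk]
      · have h3 := (eq_or_eq_of_hammingDist_add_le
          (by omega : hammingDist s u + hammingDist u t ≤ hammingDist s t) k).resolve_left hk
        have h4 := (h1.1 k).resolve_left hk
        rw [hu₀ k (Prod.ext h4.1 (h3 ▸ h4.2)), h3]
    have hgeo : ∀ k, s k = u₀ k ∨ u₀ k = t k := by
      intro k
      by_cases hk : (s k, t k) = (f α).1
      · exact Or.inr (hu₀ k hk)
      · exact Or.inl (hu₀' k hk).symm
    have hadd := hammingDist_add_eq_of hgeo
    have hcount : hammingDist s u₀ = pairCount s t (f α).1 := by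
      simp only [hammingDist, pairCount]
      congr 1
      ext k
      simp only [Finset.mem_filter, Finset.mem_univ, true_and]
      constructor
      · intro h
        by_contra hk
        exact h (hu₀' k hk).symm
      · intro h
        rw [hu₀ k h]
        intro he
        apply (f α).2
        rw [← h]
        exact he
    have hmoves : Moves (f α).1.1 (f α).1.2 s u₀ := by
      intro k
      by_cases hk : (s k, t k) = (f α).1
      · exact Or.inr ⟨congrArg Prod.fst hk, (hu₀ k hk).trans (congrArg Prod.snd hk)⟩
      · exact Or.inl (hu₀' k hk).symm
    rw [hmul, Finset.sum_eq_single u₀ (fun u _ hu => hzero u hu) (by simp), mul_pow, hX, hcount]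
    by_cases hc : pairCount s t (f α).1 = A α
    · rw [if_pos ⟨hmoves, hc⟩, one_mul, ih u₀ (by omega)]
      refine if_congr ?_ rfl rfl
      have hpc : ∀ β ∈ L, pairCount u₀ t (f β).1 = pairCount s t (f β).1 := by
        intro β hβ
        simp only [pairCount]
        congr 1
        ext k
        simp only [Finset.mem_filter, Finset.mem_univ, true_and]
        by_cases hk : (s k, t k) = (f α).1
        · rw [hu₀ k hk]
          constructor
          · intro h
            exact absurd (by rw [← h]) (f β).2
          · intro h
            exact absurd (hk.symm.trans h) (hne β hβ)
        · rw [hu₀' k hk]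
      constructor
      · rintro ⟨h1, h2⟩
        refine ⟨fun k hk => ?_, fun β hβ => ?_⟩
        · by_cases hk' : (s k, t k) = (f α).1
          · exact ⟨α, by simp, hk'⟩
          · have := h1 k
            rw [hu₀' k hk'] at this
            obtain ⟨β, hβ, h⟩ := this hk
            exact ⟨β, by simp [hβ], h⟩
        · rcases List.mem_cons.1 hβ with rfl | hβ
          · exact hc
          · rw [← hpc β hβ, h2 β hβ]
      · rintro ⟨h1, h2⟩
        refine ⟨fun k hk => ?_, fun β hβ => ?_⟩
        · by_cases hk' : (s k, t k) = (f α).1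
          · exact absurd (hu₀ k hk') hk
          · rw [hu₀' k hk'] at hk ⊢
            obtain ⟨β, hβ, h⟩ := h1 k hk
            rcases List.mem_cons.1 hβ with rfl | hβ
            · exact absurd h hk'
            · exact ⟨β, hβ, h⟩
        · rw [hpc β hβ, h2 β (by simp [hβ])]
    · rw [if_neg fun h => hc h.2, zero_mul, if_neg fun h => hc (h.2 α (by simp))]

/-! ### Types of pairs of words and the leading terms of the basis elements -/

theorem PosRoot.pos_injective {m n : ℕ} : Function.Injective (PosRoot.pos (m := m) (n := n)) := by
  intro α β h
  exact Subtype.ext (congrArg (fun r : Root m n => r.1) h)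

theorem PosRoot.neg_injective {m n : ℕ} : Function.Injective (PosRoot.neg (m := m) (n := n)) := by
  intro α β h
  have h := congrArg Subtype.val h
  simp only [PosRoot.neg, Prod.mk.injEq] at h
  exact Subtype.ext (Prod.ext h.2 h.1)

/-- The degree of a label `(A, λ, C)`: the sum of the entries of `A` and `C`. -/
def Label.degree {m n d : ℕ} {ord : List (PosRoot m n)} (t : Label d ord) : ℕ :=
  (ord.map t.1.1.1).sum + (ord.map t.1.2.2.1).sum

/-- The pair of words `(s, t)` supports the leading term of `e_A 1_λ f_C`. -/
def IsType {m n d : ℕ} {ord : List (PosRoot m n)} (l : Label d ord) (s t : Word m n d) : Prop :=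
  (∀ α : PosRoot m n, pairCount s t α.pos.1 = l.1.1.1 α) ∧
  (∀ α : PosRoot m n, pairCount s t α.neg.1 = l.1.2.2.1 α) ∧
  ∀ i, (Finset.univ.filter fun k => max (s k) (t k) = i).card = l.1.2.1.1 i

section

variable {m n d : ℕ} {ord : List (PosRoot m n)}

theorem pairCount_max_pos (s t : Word m n d) (α : PosRoot m n) :
    pairCount s (fun k => max (s k) (t k)) α.pos.1 = pairCount s t α.pos.1 := by
  obtain ⟨⟨i, j⟩, this⟩ := α
  refine congrArg Finset.card (Finset.filter_congr fun k _ => ?_)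
  change (s k, max (s k) (t k)) = (i, j) ↔ (s k, t k) = (i, j)
  simp only [Prod.mk.injEq] at this ⊢
  constructor
  · rintro ⟨rfl, h⟩
    refine ⟨rfl, ?_⟩
    rcases max_choice (s k) (t k) with h' | h'
    · exact absurd (h'.symm.trans h) this.ne
    · exact h'.symm.trans h
  · rintro ⟨rfl, rfl⟩
    exact ⟨rfl, max_eq_right this.le⟩

theorem pairCount_max_neg (s t : Word m n d) (α : PosRoot m n) :
    pairCount (fun k => max (s k) (t k)) t α.neg.1 = pairCount s t α.neg.1 := by
  obtain ⟨⟨i, j⟩, this⟩ := α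
  refine congrArg Finset.card (Finset.filter_congr fun k _ => ?_)
  change (max (s k) (t k), t k) = (j, i) ↔ (s k, t k) = (j, i)
  simp only [Prod.mk.injEq] at this ⊢
  constructor
  · rintro ⟨h, rfl⟩
    refine ⟨?_, rfl⟩
    rcases max_choice (s k) (t k) with h' | h'
    · exact h'.symm.trans h
    · exact absurd (h'.symm.trans h) this.ne
  · rintro ⟨rfl, rfl⟩
    exact ⟨max_eq_left this.le, rfl⟩

/-- Passing from s to max(s, t) affects exactly the places with s_k < t_k, and `ord` contains every
positive root, so the support condition in `Fits` is automatic. -/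
theorem fits_pos_max_iff (hall : ∀ α, α ∈ ord) (A : PosRoot m n → ℕ) (s t : Word m n d) :
    Fits PosRoot.pos A ord s (fun k => max (s k) (t k))
      ↔ ∀ α : PosRoot m n, pairCount s t α.pos.1 = A α := by
  constructor
  · intro h α
    rw [← h.2 α (hall α), pairCount_max_pos]
  · intro h
    refine ⟨fun k hk => ?_, fun α _ => by rw [pairCount_max_pos, h]⟩
    exact ⟨⟨(s k, max (s k) (t k)), lt_of_le_of_ne (le_max_left _ _) hk⟩, hall _, rfl⟩

theorem fits_neg_max_iff (hall : ∀ α, α ∈ ord) (A : PosRoot m n → ℕ) (s t : Word m n d) :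
    Fits PosRoot.neg A ord (fun k => max (s k) (t k)) t
      ↔ ∀ α : PosRoot m n, pairCount s t α.neg.1 = A α := by
  constructor
  · intro h α
    rw [← h.2 α (hall α), pairCount_max_neg]
  · intro h
    refine ⟨fun k hk => ?_, fun α _ => by rw [pairCount_max_neg, h]⟩
    exact ⟨⟨(t k, max (s k) (t k)), lt_of_le_of_ne (le_max_right _ _) hk.symm⟩, hall _, rfl⟩

theorem hammingDist_max_add (s t : Word m n d) :
    hammingDist s (fun k => max (s k) (t k)) + hammingDist (fun k => max (s k) (t k)) t
      = hammingDist s t :=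
  hammingDist_add_eq_of fun k => by
    rcases max_choice (s k) (t k) with h | h
    · exact Or.inl h.symm
    · exact Or.inr h

theorem IsType.hammingDist_eq (hnodup : ord.Nodup) (hall : ∀ α, α ∈ ord) {l : Label d ord}
    {s t : Word m n d} (h : IsType l s t) : hammingDist s t = l.degree := by
  rw [← hammingDist_max_add, Label.degree,
    ((fits_pos_max_iff hall _ s t).2 h.1).hammingDist_eq PosRoot.pos_injective hnodup,
    ((fits_neg_max_iff hall _ s t).2 h.2.1).hammingDist_eq PosRoot.neg_injective hnodup]

theorem ite_mul_ite_sq_mul_ite (P Q R : Prop) [Decidable P] [Decidable Q] [Decidable R]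
    [Decidable (P ∧ R ∧ Q)] :
    (if P then (1 : ℚ) else 0) * (if Q then 1 else 0) ^ 2 * (if R then 1 else 0)
      = if P ∧ R ∧ Q then 1 else 0 := by
  by_cases hP : P <;> by_cases hQ : Q <;> by_cases hR : R <;> simp [hP, hQ, hR]

open scoped Classical in
/-- The leading coefficients of `e_A 1_λ f_C`. -/
theorem toMat_basisElt_sq (hnodup : ord.Nodup) (hall : ∀ α, α ∈ ord) (l : Label d ord)
    {s t : Word m n d} (hst : l.degree ≤ hammingDist s t) :
    toMat m n d (basisElt ord l) s t ^ 2 = if IsType l s t then 1 else 0 := by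
  obtain ⟨⟨A, lam, C⟩, hl⟩ := l
  simp only [Label.degree] at hst
  have hE := fun u (h : (ord.map A.1).sum ≤ hammingDist s u) =>
    toMat_rootProd_sq PosRoot.pos_injective (fun α => A.2 α) hnodup h
  have hF := fun u (h : (ord.map C.1).sum ≤ hammingDist u t) =>
    toMat_rootProd_sq PosRoot.neg_injective (f := PosRoot.neg)
      (fun α h => C.2 α (by rw [add_comm]; exact h)) hnodup h
  change ∀ u, _ → toMat m n d (KMonomial.eval d (eMon ord A)) s u ^ 2 = _ at hE
  change ∀ u, _ → toMat m n d (KMonomial.eval d (fMon ord C)) u t ^ 2 = _ at hF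
  have hmul : toMat m n d (basisElt ord ⟨(A, lam, C), hl⟩) s t
      = ∑ u, toMat m n d (KMonomial.eval d (eMon ord A)) s u
          * (if ∀ i, (Finset.univ.filter fun l => u l = i).card = lam.1 i then 1 else 0)
          * toMat m n d (KMonomial.eval d (fMon ord C)) u t := by
    rw [basisElt, map_mul, map_mul, toMat_hMon, Matrix.mul_apply]
    refine Finset.sum_congr rfl fun u _ => ?_
    rw [Matrix.mul_diagonal]
  rw [hmul]
  set X := toMat m n d (KMonomial.eval d (eMon ord A)) with hX
  set Z := toMat m n d (KMonomial.eval d (fMon ord C)) with hZ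
  -- A nonzero entry further away would have to fit A, but fitting pairs are at distance exactly
  -- |A|.
  have hEle : ∀ u, X s u ≠ 0 → hammingDist s u ≤ (ord.map A.1).sum := by
    intro u hu
    by_contra h
    push Not at h
    have h1 := pow_ne_zero 2 hu
    rw [hE u h.le] at h1
    by_cases hfit : Fits PosRoot.pos A.1 ord s u
    · exact h.ne' (hfit.hammingDist_eq PosRoot.pos_injective hnodup)
    · exact h1 (if_neg hfit)
  have hFle : ∀ u, Z u t ≠ 0 → hammingDist u t ≤ (ord.map C.1).sum := by
    intro u hu
    by_contra h
    push Not at h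
    have h1 := pow_ne_zero 2 hu
    rw [hF u h.le] at h1
    by_cases hfit : Fits PosRoot.neg C.1 ord u t
    · exact h.ne' (hfit.hammingDist_eq PosRoot.neg_injective hnodup)
    · exact h1 (if_neg hfit)
  rw [Finset.sum_eq_single (fun k => max (s k) (t k))]
  · by_cases hd : hammingDist s (fun k => max (s k) (t k)) = (ord.map A.1).sum
        ∧ hammingDist (fun k => max (s k) (t k)) t = (ord.map C.1).sum
    · rw [mul_pow, mul_pow, hE _ hd.1.ge, hF _ hd.2.ge]
      have hiff : IsType ⟨(A, lam, C), hl⟩ s t ↔ _ ∧ _ ∧ _ :=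
        and_congr (fits_pos_max_iff hall A.1 s t).symm
          (and_congr_left' (fits_neg_max_iff hall C.1 s t).symm)
      rw [if_congr hiff rfl rfl]
      exact ite_mul_ite_sq_mul_ite _ _ _
    · have hnt : ¬ IsType ⟨(A, lam, C), hl⟩ s t := by
        intro h
        exact hd ⟨((fits_pos_max_iff hall _ s t).2 h.1).hammingDist_eq
            PosRoot.pos_injective hnodup,
          ((fits_neg_max_iff hall _ s t).2 h.2.1).hammingDist_eq PosRoot.neg_injective hnodup⟩
      rw [if_neg hnt]
      by_contra h0
      have h0 := (pow_ne_zero_iff two_ne_zero).1 h0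
      have h1 := hEle _ (left_ne_zero_of_mul (left_ne_zero_of_mul h0))
      have h2 := hFle _ (right_ne_zero_of_mul h0)
      have h3 := hammingDist_max_add s t
      exact hd (by omega)
  -- The distance bounds force both factors to be leading entries. Then u lies above s and t, and on
  -- a geodesic between them, which leaves only the maximum.
  · intro u _ hu
    by_contra h0
    have hx := left_ne_zero_of_mul (left_ne_zero_of_mul h0)
    have hz := right_ne_zero_of_mul h0
    have h1 := hEle _ hx
    have h2 := hFle _ hz
    have htri := hammingDist_triangle s u t
    have hfe : Fits PosRoot.pos A.1 ord s u := by
      by_contra h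
      exact pow_ne_zero 2 hx (by rw [hE u (by omega), if_neg h])
    have hff : Fits PosRoot.neg C.1 ord u t := by
      by_contra h
      exact pow_ne_zero 2 hz (by rw [hF u (by omega), if_neg h])
    apply hu
    funext k
    have hsu : s k ≤ u k := by
      by_cases h : s k = u k
      · exact h.le
      · obtain ⟨α, _, hα⟩ := hfe.1 k h
        have := α.2.le
        simp only [PosRoot.pos] at hα
        rw [← hα] at this
        exact this
    have htu : t k ≤ u k := by
      by_cases h : u k = t k
      · exact h.ge
      · obtain ⟨α, _, hα⟩ := hff.1 k h
        have := α.2.le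
        simp only [PosRoot.neg, Prod.mk.injEq] at hα
        rw [← hα.1, ← hα.2] at this
        exact this
    refine le_antisymm ?_ (max_le hsu htu)
    rcases eq_or_eq_of_hammingDist_add_le
      (by omega : hammingDist s u + hammingDist u t ≤ hammingDist s t) k with h | h
    · exact h ▸ le_max_left _ _
    · exact h ▸ le_max_right _ _
  · simp

end

/-! ### Invariance under signed place permutations -/

section

variable {m n d : ℕ}

/-- The sign from interchanging the letters of `s` at the places `k` and `k'`. -/
def swapSign (k k' : Fin d) (s : Word m n d) : ℚ := sgn (parity m n (s k)) (parity m n (s k'))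

theorem swapSign_mul_self (k k' : Fin d) (s : Word m n d) :
    swapSign k k' s * swapSign k k' s = 1 := sgn_mul_self _ _

/-- The matrices of the operators on `V^{⊗ d}` that commute with the signed action of the
symmetric group. -/
def invariants (m n d : ℕ) : Subalgebra ℚ (Matrix (Word m n d) (Word m n d) ℚ) where
  carrier := {T | ∀ k k' : Fin d, k'.val = k.val + 1 → ∀ s t : Word m n d,
    T (s ∘ Equiv.swap k k') (t ∘ Equiv.swap k k')
      = swapSign k k' s * swapSign k k' t * T s t}
  mul_mem' := by
    intro T T' hT hT' k k' hk s t
    let e : Word m n d ≃ Word m n d := (Equiv.swap k k').arrowCongr (Equiv.refl _)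
    have he : ∀ u, e u = u ∘ Equiv.swap k k' := by
      intro u
      simp [e, Equiv.arrowCongr]
    rw [Matrix.mul_apply, Matrix.mul_apply, ← Equiv.sum_comp e, Finset.mul_sum]
    refine Finset.sum_congr rfl fun u _ => ?_
    rw [he, hT k k' hk, hT' k k' hk]
    linear_combination (swapSign k k' s * swapSign k k' t * T s u * T' u t) *
      swapSign_mul_self k k' u
  add_mem' := by
    intro T T' hT hT' k k' hk s t
    rw [Matrix.add_apply, Matrix.add_apply, hT k k' hk, hT' k k' hk]
    ring
  algebraMap_mem' := by
    intro c k k' hk s t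
    rw [Matrix.algebraMap_matrix_apply, Matrix.algebraMap_matrix_apply]
    have : s ∘ Equiv.swap k k' = t ∘ Equiv.swap k k' ↔ s = t :=
      (Equiv.surjective _).injective_comp_right.eq_iff
    simp only [this]
    split_ifs with h
    · rw [h, swapSign_mul_self, one_mul]
    · simp

theorem sgn_add_right (a b c : ZMod 2) : sgn a (b + c) = sgn a b * sgn a c := by
  rw [sgn_comm, sgn_add_left, sgn_comm b, sgn_comm c]

theorem prod_Iio_succ {k k' : Fin d} (hk : k'.val = k.val + 1) (g : Fin d → ℚ) :
    ∏ l ∈ Finset.Iio k', g l = g k * ∏ l ∈ Finset.Iio k, g l := by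
  have : Finset.Iio k' = insert k (Finset.Iio k) := by
    ext l
    simp only [Finset.mem_Iio, Finset.mem_insert, Fin.lt_def, Fin.ext_iff]
    omega
  rw [this, Finset.prod_insert (by simp)]

/-- As k and k' are adjacent, an initial segment below `a` contains both or neither of them unless
`a` is k' itself. -/
theorem prod_Iio_comp_swap {k k' : Fin d} (hk : k'.val = k.val + 1) {a : Fin d} (ha : a ≠ k')
    (g : Fin d → ℚ) :
    ∏ l ∈ Finset.Iio a, g (Equiv.swap k k' l) = ∏ l ∈ Finset.Iio a, g l := by
  refine Finset.prod_equiv (Equiv.swap k k') (fun l => ?_) fun _ _ => rfl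
  simp only [Finset.mem_Iio]
  rcases eq_or_ne l k with rfl | h1
  · rw [Equiv.swap_apply_left]
    simp only [Fin.lt_def, ne_eq, Fin.ext_iff] at *
    omega
  · rcases eq_or_ne l k' with rfl | h2
    · rw [Equiv.swap_apply_right]
      simp only [Fin.lt_def, ne_eq, Fin.ext_iff] at *
      omega
    · rw [Equiv.swap_apply_of_ne_of_ne h1 h2]

/-- The summand at place a is matched with the one at the swapped place. The sign from passing the
factors on the left changes only when a is k or k', by the sign of passing one letter; the two swap
signs multiply to exactly this sign, since s and t agree at the other of the two places. -/
theorem toMat_unitS_mem_invariants (i j : Fin (m + n)) :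
    toMat m n d (unitS m n d i j) ∈ invariants m n d := by
  intro k k' hk s t
  rw [toMat_unitS, toMat_unitS, Finset.mul_sum,
    ← Equiv.sum_comp (Equiv.swap k k') (fun a => swapSign k k' s * swapSign k k' t * _)]
  refine Finset.sum_congr rfl fun a _ => ?_
  have hkk : k ≠ k' := by
    intro h
    rw [h] at hk
    omega
  set σ := Equiv.swap k k' with hσ
  have hcond : ((s ∘ σ) a = i ∧ (t ∘ σ) a = j ∧ ∀ l ≠ a, (s ∘ σ) l = (t ∘ σ) l)
      ↔ (s (σ a) = i ∧ t (σ a) = j ∧ ∀ l ≠ σ a, s l = t l) := by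
    refine and_congr Iff.rfl (and_congr Iff.rfl ⟨fun h l hl => ?_, fun h l hl => ?_⟩)
    · have := h (σ.symm l) (fun h' => hl (by rw [← h', Equiv.apply_symm_apply]))
      simpa using this
    · exact h (σ l) (fun h' => hl (σ.injective h'))
  rw [if_congr hcond rfl rfl]
  split_ifs with h
  swap
  · rw [mul_zero]
  obtain ⟨h1, h2, h3⟩ := h
  let g : Fin d → ℚ := fun l => sgn (parity m n i + parity m n j) (parity m n (t l))
  change ∏ l ∈ Finset.Iio a, g (σ l) = swapSign k k' s * swapSign k k' t *
    ∏ l ∈ Finset.Iio (σ a), g l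
  have hg : ∀ l, g l * g l = 1 := fun l => sgn_mul_self _ _
  rcases eq_or_ne a k with rfl | hak
  · rw [prod_Iio_comp_swap hk hkk]
    rw [hσ, Equiv.swap_apply_left] at h1 h2 h3 ⊢
    rw [prod_Iio_succ hk]
    have : swapSign a k' s * swapSign a k' t = g a := by
      simp only [swapSign, g]
      rw [h3 a hkk, h1, h2, sgn_comm (_ + _), sgn_add_right]
    rw [this]
    linear_combination -(∏ l ∈ Finset.Iio a, g l) * hg a
  · rcases eq_or_ne a k' with rfl | hak'
    · rw [prod_Iio_succ hk, prod_Iio_comp_swap hk hkk]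
      rw [hσ, Equiv.swap_apply_right] at h1 h2 h3 ⊢
      have : swapSign k a s * swapSign k a t = g a := by
        simp only [swapSign, g]
        rw [h3 a hkk.symm, h1, h2, sgn_add_left]
      rw [this, Equiv.swap_apply_left]
    · rw [prod_Iio_comp_swap hk hak']
      rw [hσ, Equiv.swap_apply_of_ne_of_ne hak hak'] at h3 ⊢
      have : swapSign k k' s * swapSign k k' t = 1 := by
        simp only [swapSign]
        rw [h3 k hak.symm, h3 k' hak'.symm, sgn_mul_self]
      rw [this, one_mul]

theorem toMat_mem_invariants (x : Schur m n d) : toMat m n d x ∈ invariants m n d := by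
  obtain ⟨x, y, rfl⟩ := x
  obtain ⟨z, rfl⟩ := RingQuot.mkAlgHom_surjective ℚ (EnvRel m n) y
  change LinearMap.toMatrixAlgEquiv (wordBasis m n d)
    (rho m n d (RingQuot.mkAlgHom ℚ (EnvRel m n) z)) ∈ _
  rw [rho, RingQuot.liftAlgHom_mkAlgHom_apply]
  induction z using TensorAlgebra.induction with
  | algebraMap c =>
    rw [AlgHom.commutes, AlgEquiv.commutes]
    exact (invariants m n d).algebraMap_mem c
  | ι x =>
    rw [TensorAlgebra.lift_ι_apply, Matrix.matrix_eq_sum_single x, map_sum, map_sum]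
    refine Subalgebra.sum_mem _ fun i _ => ?_
    rw [map_sum, map_sum]
    refine Subalgebra.sum_mem _ fun j _ => ?_
    have : (Matrix.single i j (x i j) : Gl m n) = x i j • Matrix.single i j 1 := by simp
    rw [this, map_smul, map_smul, ← unitS_val]
    exact Subalgebra.smul_mem _ (toMat_unitS_mem_invariants i j) _
  | mul a b ha hb =>
    rw [map_mul, map_mul]
    exact Subalgebra.mul_mem _ ha hb
  | add a b ha hb =>
    rw [map_add, map_add]
    exact Subalgebra.add_mem _ ha hb

/-- Adjacent transpositions generate the symmetric group and change entries only by signs. Tracking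
vanishing alone avoids computing the sign of a general permutation. -/
theorem invariants_apply_comp_perm {T : Matrix (Word m n d) (Word m n d) ℚ}
    (hT : T ∈ invariants m n d) (σ : Equiv.Perm (Fin d)) {s t : Word m n d} (h : T s t = 0) :
    T (s ∘ σ) (t ∘ σ) = 0 := by
  cases d with
  | zero => exact (by rw [Subsingleton.elim (s ∘ σ) s, Subsingleton.elim (t ∘ σ) t, h])
  | succ d =>
    have hσ : σ ∈ Submonoid.closure
        (Set.range fun i : Fin d ↦ Equiv.swap i.castSucc i.succ) := by
      rw [Equiv.Perm.mclosure_swap_castSucc_succ]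
      trivial
    induction hσ using Submonoid.closure_induction generalizing s t with
    | mem σ hσ =>
      obtain ⟨i, rfl⟩ := hσ
      rw [hT _ _ (by simp), h, mul_zero]
    | one => exact h
    | mul σ τ _ _ hσ hτ => exact hτ (hσ h)

theorem exists_perm_apply_eq {α : Type*} [DecidableEq α] {a b k l : α} (hab : a ≠ b)
    (hkl : k ≠ l) : ∃ σ : Equiv.Perm α, σ a = k ∧ σ b = l := by
  refine ⟨(Equiv.swap b (Equiv.swap a k l)).trans (Equiv.swap a k), ?_, ?_⟩
  · have h : a ≠ Equiv.swap a k l := by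
      intro h
      apply hkl
      have := congrArg (Equiv.swap a k) h
      rwa [Equiv.swap_apply_left, Equiv.swap_apply_self] at this
    rw [Equiv.trans_apply, Equiv.swap_apply_of_ne_of_ne hab h, Equiv.swap_apply_left]
  · rw [Equiv.trans_apply, Equiv.swap_apply_left, Equiv.swap_apply_self]

/-- Invariant operators have no coefficients at pairs of words with a repeated odd pair of
letters. -/
theorem invariants_apply_eq_zero_of_odd {T : Matrix (Word m n d) (Word m n d) ℚ}
    (hT : T ∈ invariants m n d) {s t : Word m n d} {k l : Fin d} (hkl : k ≠ l)
    (hs : s k = s l) (ht : t k = t l) (hodd : parity m n (s k) + parity m n (t k) = 1) :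
    T s t = 0 := by
  have hd : 2 ≤ d := by
    have := k.2
    have := l.2
    have : k.val ≠ l.val := fun h => hkl (Fin.ext h)
    omega
  -- The defining relation concerns adjacent places, so k and l are carried to the places 0 and 1.
  -- The swap then fixes both words but has sign -1, so the entry equals its negative.
  let a : Fin d := ⟨0, by omega⟩
  let b : Fin d := ⟨1, by omega⟩
  have hab : a ≠ b := by simp [a, b, Fin.ext_iff]
  obtain ⟨σ, hσa, hσb⟩ := exists_perm_apply_eq hab hkl
  have hswap : ∀ u : Word m n d, u k = u l → (u ∘ σ) ∘ Equiv.swap a b = u ∘ σ := by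
    intro u hu
    funext c
    simp only [Function.comp_apply]
    rcases eq_or_ne c a with rfl | h1
    · rw [Equiv.swap_apply_left, hσa, hσb, hu]
    · rcases eq_or_ne c b with rfl | h2
      · rw [Equiv.swap_apply_right, hσa, hσb, hu]
      · rw [Equiv.swap_apply_of_ne_of_ne h1 h2]
  have h0 : T (s ∘ σ) (t ∘ σ) = 0 := by
    have h := hT a b rfl (s ∘ σ) (t ∘ σ)
    rw [hswap s hs, hswap t ht] at h
    have hsign : swapSign a b (s ∘ σ) * swapSign a b (t ∘ σ) = -1 := by
      simp only [swapSign, Function.comp_apply, hσa, hσb, ← hs, ← ht]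
      generalize parity m n (s k) = x at hodd
      generalize parity m n (t k) = y at hodd
      have e0 : sgn 0 0 = 1 := sgn_zero_left 0
      have e1 : sgn 1 1 = -1 := by
        have : (1 : ZMod 2).val = 1 := rfl
        simp [sgn, this]
      rcases zmod_two_cases x with rfl | rfl
      · rw [zero_add] at hodd
        rw [hodd, e0, e1, one_mul]
      · have : y = 0 := by simpa using hodd
        rw [this, e0, e1, mul_one]
    rw [hsign] at h
    linarith
  have := invariants_apply_comp_perm hT σ⁻¹ h0
  have e : ∀ u : Word m n d, (u ∘ σ) ∘ (σ⁻¹ : Equiv.Perm (Fin d)) = u := by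
    intro u
    funext c
    simp
  rwa [e, e] at this

end

/-! ### Labels as orbits of pairs of words -/

section

variable {m n d : ℕ} {ord : List (PosRoot m n)}

theorem sum_pairs_eq (f : Fin (m + n) × Fin (m + n) → ℕ) :
    ∑ p, f p = ∑ i, f (i, i) + ∑ α : PosRoot m n, (f α.pos.1 + f α.neg.1) := by
  have h : ∀ p : Fin (m + n) × Fin (m + n), f p = (if p.1 = p.2 then f p else 0)
      + ((if p.1 < p.2 then f p else 0) + (if p.2 < p.1 then f p else 0)) := by
    intro p
    rcases lt_trichotomy p.1 p.2 with h | h | h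
    · simp [h, h.ne, h.not_gt]
    · simp [h]
    · simp [h, h.ne', h.not_gt]
  rw [Finset.sum_congr rfl fun p _ => h p, Finset.sum_add_distrib, Finset.sum_add_distrib,
    Finset.sum_add_distrib]
  congr 1
  · rw [Fintype.sum_prod_type]
    simp
  · congr 1
    · rw [← Finset.sum_filter]
      exact Finset.sum_subtype _ (by simp) f
    · have e : ∑ p : Fin (m + n) × Fin (m + n), (if p.2 < p.1 then f p else 0)
          = ∑ p : Fin (m + n) × Fin (m + n), if p.1 < p.2 then f p.swap else 0 :=
        Fintype.sum_equiv (Equiv.prodComm _ _) _ _ fun p => by simp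
      rw [e, ← Finset.sum_filter]
      exact Finset.sum_subtype _ (by simp) (fun p : Fin (m + n) × Fin (m + n) => f p.swap)

/-- A place where the maximum is j carries either (j, j) or the two letters of a positive root with
larger index j, in one of the two orders. This is where the content function comes from. -/
theorem card_max_eq (s t : Word m n d) (j : Fin (m + n)) :
    (Finset.univ.filter fun k => max (s k) (t k) = j).card
      = pairCount s t (j, j) + ∑ α : PosRoot m n,
          if α.1.2 = j then pairCount s t α.pos.1 + pairCount s t α.neg.1 else 0 := by
  have h := sum_pairs_eq (m := m) (n := n)
    fun p => if max p.1 p.2 = j then pairCount s t p else 0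
  have h1 : ∑ i, (if max i i = j then pairCount s t (i, i) else 0) = pairCount s t (j, j) := by
    simp
  have h2 : ∀ α : PosRoot m n, (if max α.pos.1.1 α.pos.1.2 = j then pairCount s t α.pos.1 else 0)
      + (if max α.neg.1.1 α.neg.1.2 = j then pairCount s t α.neg.1 else 0)
      = if α.1.2 = j then pairCount s t α.pos.1 + pairCount s t α.neg.1 else 0 := by
    intro α
    have e1 : max α.pos.1.1 α.pos.1.2 = α.1.2 := max_eq_right α.2.le
    have e2 : max α.neg.1.1 α.neg.1.2 = α.1.2 := max_eq_left α.2.le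
    rw [e1, e2]
    split_ifs <;> simp
  rw [h1, Finset.sum_congr rfl fun α _ => h2 α] at h
  rw [← h, ← Finset.sum_filter, Finset.card_eq_sum_card_fiberwise (f := fun k => (s k, t k))
    (t := Finset.univ.filter fun p : Fin (m + n) × Fin (m + n) => max p.1 p.2 = j)]
  · refine Finset.sum_congr rfl fun p hp => ?_
    rw [pairCount]
    congr 1
    ext k
    simp only [Finset.mem_filter, Finset.mem_univ, true_and] at hp ⊢
    constructor
    · exact fun h => h.2
    · intro h
      refine ⟨?_, h⟩
      rw [← h] at hp
      exact hp
  · intro k hk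
    simpa using hk

theorem content_eq (hnodup : ord.Nodup) (hall : ∀ α, α ∈ ord) (A C : RootTuple m n)
    (j : Fin (m + n)) :
    KMonomial.content (eMon ord A ++ fMon ord C) j
      = ∑ α : PosRoot m n, if α.1.2 = j then A.1 α + C.1 α else 0 := by
  classical
  have key : ∀ (f : PosRoot m n → Root m n) (B : PosRoot m n → ℕ),
      (∀ α, max (f α).1.1 (f α).1.2 = α.1.2) →
      KMonomial.content (ord.map fun α => KFactor.root (f α) (B α)) j
        = ∑ α : PosRoot m n, if α.1.2 = j then B α else 0 := by
    intro f B hf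
    have huniv : (Finset.univ : Finset (PosRoot m n)) = ord.toFinset := by
      ext α
      simp [hall α]
    rw [huniv, List.sum_toFinset _ hnodup, KMonomial.content, List.map_map]
    clear huniv hnodup hall
    induction ord with
    | nil => rfl
    | cons α L ih =>
      simp only [List.map_cons, List.sum_cons, Pi.add_apply, ih]
      congr 1
      simp only [Function.comp_apply, KFactor.content, hf, Pi.single_apply, eq_comm]
  rw [KMonomial.content, List.map_append, List.sum_append, Pi.add_apply]
  have h1 := key PosRoot.pos A.1 fun α => max_eq_right α.2.le
  have h2 := key PosRoot.neg C.1 fun α => max_eq_left α.2.le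
  change (List.map KFactor.content (eMon ord A)).sum j = _ at h1
  change (List.map KFactor.content (fMon ord C)).sum j = _ at h2
  rw [h1, h2, ← Finset.sum_add_distrib]
  refine Finset.sum_congr rfl fun α _ => ?_
  split_ifs <;> simp

/-- The d places are identified with a disjoint union of blocks, one of size `M p` for each pair p.
-/
theorem exists_word_pairCount_eq (M : Fin (m + n) × Fin (m + n) → ℕ) (hM : ∑ p, M p = d) :
    ∃ s t : Word m n d, ∀ p, pairCount s t p = M p := by
  have hc : Fintype.card (Fin d) = Fintype.card (Σ p, Fin (M p)) := by simp [hM]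
  let e := Fintype.equivOfCardEq hc
  refine ⟨fun k => (e k).1.1, fun k => (e k).1.2, fun p => ?_⟩
  rw [pairCount, ← Fintype.card_subtype]
  have e' : {k : Fin d // ((e k).1.1, (e k).1.2) = p} ≃ {x : Σ p, Fin (M p) // x.1 = p} :=
    e.subtypeEquiv fun k => by simp
  rw [Fintype.card_congr (e'.trans (Equiv.sigmaSubtype p)), Fintype.card_fin]

theorem exists_isType (hnodup : ord.Nodup) (hall : ∀ α, α ∈ ord) (l : Label d ord) :
    ∃ s t : Word m n d, IsType l s t := by
  obtain ⟨⟨A, lam, C⟩, hl⟩ := l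
  let χ : Fin (m + n) → ℕ := fun j => ∑ α : PosRoot m n, if α.1.2 = j then A.1 α + C.1 α else 0
  have hχ : ∀ j, χ j ≤ lam.1 j := by
    intro j
    have := hl j
    rwa [content_eq hnodup hall] at this
  -- A prescribes the pairs above the diagonal and C those below; the diagonal takes what λ leaves.
  -- The truncated subtraction is a true one because the content is at most λ.
  let M : Fin (m + n) × Fin (m + n) → ℕ := fun p =>
    if h : p.1 < p.2 then A.1 ⟨p, h⟩ else if h : p.2 < p.1 then C.1 ⟨(p.2, p.1), h⟩
      else lam.1 p.1 - χ p.1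
  have hMpos : ∀ α : PosRoot m n, M α.pos.1 = A.1 α := fun α => dif_pos α.2
  have hMneg : ∀ α : PosRoot m n, M α.neg.1 = C.1 α := fun α => by
    simp only [M]
    rw [dif_neg (show ¬ α.neg.1.1 < α.neg.1.2 from not_lt.2 α.2.le),
      dif_pos (show α.neg.1.2 < α.neg.1.1 from α.2)]
    rfl
  have hMdiag : ∀ i, M (i, i) = lam.1 i - χ i := fun i => by simp [M]
  have hχsum : ∑ i, χ i = ∑ α : PosRoot m n, (A.1 α + C.1 α) := by
    simp only [χ]
    rw [Finset.sum_comm]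
    simp
  obtain ⟨s, t, hst⟩ := exists_word_pairCount_eq (d := d) M (by
    rw [sum_pairs_eq]
    simp only [hMpos, hMneg, hMdiag]
    rw [← hχsum, ← Finset.sum_add_distrib]
    exact (Finset.sum_congr rfl fun i _ => Nat.sub_add_cancel (hχ i)).trans lam.2)
  refine ⟨s, t, fun α => by rw [hst, hMpos], fun α => by rw [hst, hMneg], fun i => ?_⟩
  rw [card_max_eq]
  simp only [hst, hMpos, hMneg, hMdiag]
  exact Nat.sub_add_cancel (hχ i)

/-- A repeated odd pair would make the entry vanish, so the pair counts satisfy the restriction on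
root tuples. The content condition holds because the diagonal counts are nonnegative. -/
theorem exists_isType_of_ne_zero (hnodup : ord.Nodup) (hall : ∀ α, α ∈ ord)
    {T : Matrix (Word m n d) (Word m n d) ℚ} (hT : T ∈ invariants m n d) {s t : Word m n d}
    (h : T s t ≠ 0) : ∃ l : Label d ord, IsType l s t := by
  have hodd : ∀ p : Fin (m + n) × Fin (m + n), parity m n p.1 + parity m n p.2 = 1 →
      pairCount s t p = 0 ∨ pairCount s t p = 1 := by
    intro p hp
    by_contra hc
    have : 1 < pairCount s t p := by omega
    rw [pairCount, Finset.one_lt_card] at this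
    obtain ⟨k, hk, l, hl, hkl⟩ := this
    simp only [Finset.mem_filter, Finset.mem_univ, true_and] at hk hl
    have e := hk.trans hl.symm
    refine h (invariants_apply_eq_zero_of_odd hT hkl (congrArg Prod.fst e)
      (congrArg Prod.snd e) ?_)
    rw [← hk] at hp
    exact hp
  let A : RootTuple m n := ⟨fun α => pairCount s t α.pos.1, fun α hα => hodd _ hα⟩
  let C : RootTuple m n := ⟨fun α => pairCount s t α.neg.1, fun α hα => hodd _ (by
    rw [add_comm]; exact hα)⟩
  let lam : Weight m n d :=
    ⟨fun i => (Finset.univ.filter fun k => max (s k) (t k) = i).card, by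
      rw [← Finset.card_eq_sum_card_fiberwise (fun _ _ => Finset.mem_coe.2
        (Finset.mem_univ _)), Finset.card_univ, Fintype.card_fin]⟩
  refine ⟨⟨(A, lam, C), fun j => ?_⟩, fun α => rfl, fun α => rfl, fun i => rfl⟩
  rw [content_eq hnodup hall]
  change _ ≤ (Finset.univ.filter fun k => max (s k) (t k) = j).card
  rw [card_max_eq]
  exact Nat.le_add_left _ _

/-- The label fixes the diagonal pair counts as well, by `card_max_eq`. Places carrying the same
pair of letters can then be matched by bijections, one pair at a time. -/
theorem IsType.exists_perm {l : Label d ord} {s t s' t' : Word m n d} (h : IsType l s t)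
    (h' : IsType l s' t') :
    ∃ σ : Equiv.Perm (Fin d), s' = s ∘ σ ∧ t' = t ∘ σ := by
  have hpair : ∀ p, pairCount s' t' p = pairCount s t p := by
    rintro ⟨i, j⟩
    rcases lt_trichotomy i j with hij | rfl | hij
    · exact (h'.1 ⟨(i, j), hij⟩).trans (h.1 ⟨(i, j), hij⟩).symm
    · have e := (h'.2.2 i).trans (h.2.2 i).symm
      rw [card_max_eq, card_max_eq] at e
      simp only [h.1, h.2.1, h'.1, h'.2.1] at e
      omega
    · exact (h'.2.1 ⟨(j, i), hij⟩).trans (h.2.1 ⟨(j, i), hij⟩).symm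
  have e : ∀ p, {k // (s' k, t' k) = p} ≃ {k // (s k, t k) = p} := fun p =>
    Fintype.equivOfCardEq (by
      rw [Fintype.card_subtype, Fintype.card_subtype]
      exact hpair p)
  have hmap := Equiv.ofFiberEquiv_map e
  refine ⟨Equiv.ofFiberEquiv e, ?_, ?_⟩ <;> funext k
  · exact (congrArg Prod.fst (hmap k)).symm
  · exact (congrArg Prod.snd (hmap k)).symm

theorem IsType.label_unique {l l' : Label d ord} {s t : Word m n d} (h : IsType l s t)
    (h' : IsType l' s t) : l = l' := by
  refine Subtype.ext (Prod.ext (Subtype.ext (funext fun α => ?_))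
    (Prod.ext (Subtype.ext (funext fun i => ?_)) (Subtype.ext (funext fun α => ?_))))
  · rw [← h.1, ← h'.1]
  · rw [← h.2.2, ← h'.2.2]
  · rw [← h.2.1, ← h'.2.1]

theorem finite_label (hnodup : ord.Nodup) (hall : ∀ α, α ∈ ord) : Finite (Label d ord) := by
  choose s t hst using fun l : Label d ord => exists_isType hnodup hall l
  refine Finite.of_injective (fun l => (s l, t l)) fun l l' h => ?_
  have hs : s l = s l' := congrArg Prod.fst h
  have ht : t l = t l' := congrArg Prod.snd h
  refine (hst l).label_unique ?_
  rw [hs, ht]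
  exact hst l'

/-! ### Triangularity: spanning and independence -/

/-- An invariant operator is determined modulo the operators of smaller degree by its
coefficients at representatives of the labels. -/
theorem exists_eq_sum_basisElt [Fintype (Label d ord)] (hnodup : ord.Nodup)
    (hall : ∀ α, α ∈ ord) (R : AddSubgroup ℚ) {T : Matrix (Word m n d) (Word m n d) ℚ}
    (hT : T ∈ invariants m n d) (hR : ∀ s t, T s t ∈ R)
    (hY : ∀ (l : Label d ord) (s t : Word m n d), ∀ c ∈ R,
      c * toMat m n d (basisElt ord l) s t ∈ R) :
    ∃ c : Label d ord → ℚ, (∀ l, c l ∈ R) ∧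
      T = ∑ l, c l • toMat m n d (basisElt ord l) := by
  classical
  choose s t hst using fun l : Label d ord => exists_isType hnodup hall l
  suffices H : ∀ (D : ℕ) (T : Matrix (Word m n d) (Word m n d) ℚ), T ∈ invariants m n d →
      (∀ s t, T s t ∈ R) → (∀ s t, D ≤ hammingDist s t → T s t = 0) →
      ∃ c : Label d ord → ℚ, (∀ l, c l ∈ R) ∧
        T = ∑ l, c l • toMat m n d (basisElt ord l) by
    -- Hamming distances are at most d, so the vanishing condition at `d + 1` is empty.
    refine H (d + 1) T hT hR fun s t h => ?_
    have := hammingDist_le_card_fintype (x := s) (y := t)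
    rw [Fintype.card_fin] at this
    omega
  intro D
  induction D with
  | zero =>
    intro T _ _ h0
    refine ⟨0, fun _ => R.zero_mem, ?_⟩
    ext u v
    simp [h0 u v (Nat.zero_le _)]
  | succ D ih =>
    intro T hT hR h0
    let Y := fun l => toMat m n d (basisElt ord l)
    -- The leading entry of `Y l` is ±1, hence its own inverse: multiplying by it replaces division
    -- and keeps the coefficient in `R`.
    let c : Label d ord → ℚ := fun l =>
      if l.degree = D then T (s l) (t l) * Y l (s l) (t l) else 0
    have hcR : ∀ l, c l ∈ R := by
      intro l
      simp only [c]
      split_ifs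
      · exact hY l _ _ _ (hR _ _)
      · exact R.zero_mem
    have hT' : T - ∑ l, c l • Y l ∈ invariants m n d :=
      Subalgebra.sub_mem _ hT (Subalgebra.sum_mem _ fun l _ =>
        Subalgebra.smul_mem _ (toMat_mem_invariants _) _)
    have hval : ∀ u v, (T - ∑ l, c l • Y l) u v = T u v - ∑ l, c l * Y l u v := by
      intro u v
      rw [Matrix.sub_apply, Matrix.sum_apply]
      rfl
    obtain ⟨c', hc', hsum⟩ := ih (T - ∑ l, c l • Y l) hT' (fun u v => by
      rw [hval]
      exact R.sub_mem (hR _ _) (R.sum_mem fun l _ => hY l _ _ _ (hcR l))) (fun u v huv => by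
      by_contra hne
      obtain ⟨l, hl⟩ := exists_isType_of_ne_zero hnodup hall hT' hne
      have hdeg := hl.hammingDist_eq hnodup hall
      -- By invariance the entry at the chosen representative of the orbit is nonzero too; there
      -- only the label l itself can contribute.
      have hne' : (T - ∑ l, c l • Y l) (s l) (t l) ≠ 0 := by
        intro h
        obtain ⟨σ, hσ1, hσ2⟩ := (hst l).exists_perm hl
        apply hne
        rw [hσ1, hσ2]
        exact invariants_apply_comp_perm hT' σ h
      apply hne'
      have hdeg' := (hst l).hammingDist_eq hnodup hall
      have hother : ∀ l', l' ≠ l → c l' * Y l' (s l) (t l) = 0 := by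
        intro l' hl'
        by_cases hD : l'.degree = D
        · have hsq := toMat_basisElt_sq hnodup hall l' (s := s l) (t := t l) (by omega)
          rw [if_neg fun h => hl' (h.label_unique (hst l)), sq_eq_zero_iff] at hsq
          rw [show Y l' (s l) (t l) = 0 from hsq, mul_zero]
        · rw [show c l' = 0 from if_neg hD, zero_mul]
      rw [hval, Finset.sum_eq_single l (fun l' _ h => hother l' h) (by simp)]
      by_cases hD : l.degree = D
      · have hsq := toMat_basisElt_sq hnodup hall l (s := s l) (t := t l) hdeg'.ge
        rw [if_pos (hst l)] at hsq
        rw [show c l = _ from if_pos hD]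
        change Y l (s l) (t l) ^ 2 = 1 at hsq
        linear_combination (-T (s l) (t l)) * hsq
      · rw [show c l = 0 from if_neg hD, zero_mul, sub_zero]
        exact h0 _ _ (by omega))
    refine ⟨fun l => c' l + c l, fun l => R.add_mem (hc' l) (hcR l), ?_⟩
    simp only [add_smul, Finset.sum_add_distrib]
    rw [← hsum]
    exact (sub_add_cancel _ _).symm

/-- In a relation, take a label of maximal degree among those with nonzero coefficient. At a pair of
its type every other term vanishes, while its own entry is ±1. -/
theorem linearIndependent_toMat_basisElt (hnodup : ord.Nodup) (hall : ∀ α, α ∈ ord) :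
    LinearIndependent ℚ fun l : Label d ord => toMat m n d (basisElt ord l) := by
  classical
  have := finite_label (d := d) hnodup hall
  have := Fintype.ofFinite (Label d ord)
  rw [Fintype.linearIndependent_iff]
  intro c hc
  by_contra hne
  push Not at hne
  obtain ⟨l, hl, hmax⟩ := Finset.exists_max_image
    (Finset.univ.filter fun l : Label d ord => c l ≠ 0) Label.degree
    (by obtain ⟨l, hl⟩ := hne; exact ⟨l, by simp [hl]⟩)
  simp only [Finset.mem_filter, Finset.mem_univ, true_and] at hl hmax
  obtain ⟨s, t, hst⟩ := exists_isType hnodup hall l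
  have hdeg := hst.hammingDist_eq hnodup hall
  have h := congrFun (congrFun hc s) t
  rw [Matrix.sum_apply, Finset.sum_eq_single l] at h
  · have hsq := toMat_basisElt_sq hnodup hall l hdeg.ge
    rw [if_pos hst] at hsq
    rw [Matrix.smul_apply, smul_eq_mul, Matrix.zero_apply, mul_eq_zero] at h
    rw [h.resolve_left hl] at hsq
    norm_num at hsq
  · intro l' _ hl'
    rw [Matrix.smul_apply, smul_eq_mul]
    by_cases hc' : c l' = 0
    · rw [hc', zero_mul]
    · have hsq := toMat_basisElt_sq hnodup hall l' (s := s) (t := t) (hdeg ▸ hmax l' hc')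
      rw [if_neg fun h => hl' (h.label_unique hst), sq_eq_zero_iff] at hsq
      rw [hsq, mul_zero]
  · simp

end

/-! ### A commutator formula for divided powers -/

section

variable {A : Type*} [Ring A] [Algebra ℚ A]

theorem mul_pow_sub_pow_mul {x y w : A} (hw : y * x - x * y = w) (hx : Commute w x) (k : ℕ) :
    y * x ^ k - x ^ k * y = (k : ℚ) • (x ^ (k - 1) * w) := by
  induction k with
  | zero => simp
  | succ k ih =>
    have h1 : y * x ^ (k + 1) - x ^ (k + 1) * y
        = (y * x ^ k - x ^ k * y) * x + x ^ k * (y * x - x * y) := by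
      rw [pow_succ]
      noncomm_ring
    rw [h1, ih, hw]
    rcases k with _ | k
    · simp
    · rw [smul_mul_assoc, mul_assoc, hx.eq, ← mul_assoc, Nat.add_sub_cancel, ← pow_succ,
        Nat.add_sub_cancel]
      push_cast
      module

/-- Since w commutes with x and y, the operator ad y acts on powers of x like w times
differentiation. -/
theorem ad_pow_apply_pow {x y w : A} (hw : y * x - x * y = w) (hx : Commute w x)
    (hy : Commute w y) (r t : ℕ) :
    ((LinearMap.mulLeft ℚ y + LinearMap.mulRight ℚ (-y)) ^ t) (x ^ r)
      = (r.descFactorial t : ℚ) • (x ^ (r - t) * w ^ t) := by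
  induction t with
  | zero => simp
  | succ t ih =>
    have h := mul_pow_sub_pow_mul hw hx (r - t)
    have h' : y * (x ^ (r - t) * w ^ t) + x ^ (r - t) * w ^ t * -y
        = (y * x ^ (r - t) - x ^ (r - t) * y) * w ^ t := by
      rw [mul_neg, mul_assoc (x ^ (r - t)), (hy.pow_left t).eq]
      noncomm_ring
    rw [pow_succ', Module.End.mul_apply, ih, map_smul, LinearMap.add_apply,
      LinearMap.mulLeft_apply, LinearMap.mulRight_apply, h', h, smul_mul_assoc, smul_smul,
      mul_assoc, ← pow_succ', Nat.descFactorial_succ, Nat.sub_sub]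
    push_cast
    rw [mul_comm]

/-- Applying ad y to x^r exactly r times gives r! w^r. As ad y is the sum of the commuting operators
of left multiplication by y and right multiplication by -y, the binomial theorem expands the same
element; dividing by (r!)² leaves coefficients ±1. -/
theorem divPow_eq_sum {x y w : A} (hw : y * x - x * y = w) (hx : Commute w x)
    (hy : Commute w y) (r : ℕ) :
    divPow w r = ∑ k ∈ Finset.range (r + 1),
      divPow y k * divPow x r * ((-1) ^ (r - k) * divPow y (r - k)) := by
  have h := ad_pow_apply_pow hw hx hy r r
  have hcomm : Commute (LinearMap.mulLeft ℚ y) (LinearMap.mulRight ℚ (-y)) :=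
    LinearMap.commute_mulLeft_right y (-y)
  rw [hcomm.add_pow, Nat.descFactorial_self, Nat.sub_self,
    pow_zero, one_mul, LinearMap.sum_apply] at h
  have hr : (r.factorial : ℚ) ≠ 0 := by exact_mod_cast r.factorial_ne_zero
  have hdiv : divPow w r
      = ((r.factorial : ℚ)⁻¹ * (r.factorial : ℚ)⁻¹) • ((r.factorial : ℚ) • w ^ r) := by
    rw [divPow, smul_smul, mul_assoc, inv_mul_cancel₀ hr, mul_one]
  rw [hdiv, ← h, Finset.smul_sum]
  refine Finset.sum_congr rfl fun k hk => ?_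
  have hk : k ≤ r := Nat.lt_succ_iff.1 (Finset.mem_range.1 hk)
  have hchoose : ((r.choose k : ℕ) : Module.End ℚ A) = (r.choose k : ℚ) • 1 := by
    rw [← Nat.smul_one_eq_cast, Nat.cast_smul_eq_nsmul]
  rw [hchoose, LinearMap.pow_mulLeft, LinearMap.pow_mulRight, mul_smul_comm, mul_one,
    LinearMap.smul_apply, Module.End.mul_apply, LinearMap.mulLeft_apply,
    LinearMap.mulRight_apply, neg_pow y]
  simp only [divPow, smul_mul_assoc, mul_smul_comm, smul_smul, mul_assoc]
  congr 1
  rw [Nat.choose_eq_factorial_div_factorial hk,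
    Nat.cast_div (Nat.factorial_mul_factorial_dvd_factorial hk)
      (by exact_mod_cast mul_ne_zero k.factorial_ne_zero (r - k).factorial_ne_zero)]
  have hk1 : (k.factorial : ℚ) ≠ 0 := by exact_mod_cast k.factorial_ne_zero
  have hk2 : ((r - k).factorial : ℚ) ≠ 0 := by exact_mod_cast (r - k).factorial_ne_zero
  push_cast
  field_simp

theorem divPow_mem_of_commutator {K : Subring A} {x y w : A} (hw : y * x - x * y = w)
    (hx : Commute w x) (hy : Commute w y) (hxK : ∀ r, divPow x r ∈ K)
    (hyK : ∀ r, divPow y r ∈ K) (r : ℕ) : divPow w r ∈ K := by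
  rw [divPow_eq_sum hw hx hy]
  exact K.sum_mem fun k _ => K.mul_mem (K.mul_mem (hyK _) (hxK _))
    (K.mul_mem (K.pow_mem (K.neg_mem K.one_mem) _) (hyK _))

end

/-! ### The Kostant form and integrality -/

section

variable {m n d : ℕ} {ord : List (PosRoot m n)}

theorem sgn_smul_mem (a b : ZMod 2) {K : Subring (Schur m n d)} {x : Schur m n d} (hx : x ∈ K) :
    sgn a b • x ∈ K := by
  rcases neg_one_pow_eq_or ℚ (a.val * b.val) with h | h
  · rw [sgn, h, one_smul]
    exact hx
  · rw [sgn, h, neg_one_smul]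
    exact K.neg_mem hx

/-- If the root is even, `hpar` makes both shorter roots even, so the bracket is an ordinary
commutator commuting with both factors and the formula above applies. If it is odd, only the powers
0 and 1 survive, and the superbracket gives the latter. -/
theorem divPow_unitS_mem_of {K : Subring (Schur m n d)} {i k j : Fin (m + n)} (hij : i ≠ j)
    (hik : i ≠ k) (hkj : k ≠ j)
    (hpar : parity m n i = parity m n j → parity m n k = parity m n i)
    (h1 : ∀ r, divPow (unitS m n d i k) r ∈ K) (h2 : ∀ r, divPow (unitS m n d k j) r ∈ K)
    (r : ℕ) : divPow (unitS m n d i j) r ∈ K := by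
  have hb := unitS_bracket (d := d) i k k j
  rw [if_pos rfl, if_neg hij.symm, smul_zero, sub_zero] at hb
  rcases zmod_two_cases (parity m n i + parity m n j) with h | h
  · have hpij : parity m n i = parity m n j := by
      rwa [CharTwo.add_eq_zero] at h
    have hk := hpar hpij
    have e1 : parity m n i + parity m n k = 0 := by rw [hk, CharTwo.add_self_eq_zero]
    rw [e1, sgn_zero_left, one_smul] at hb
    have hx := unitS_bracket (d := d) i j k j
    rw [if_neg hkj.symm, if_neg hij.symm, h, sgn_zero_left, one_smul, one_smul, sub_zero,
      sub_eq_zero] at hx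
    have hy := unitS_bracket (d := d) i j i k
    rw [if_neg hij.symm, if_neg hik.symm, h, sgn_zero_left, one_smul, one_smul, sub_zero,
      sub_eq_zero] at hy
    exact divPow_mem_of_commutator hb hx hy h2 h1 r
  · rcases r with _ | _ | r
    · rw [divPow_zero]
      exact K.one_mem
    · rw [zero_add, divPow_one, ← hb]
      have g1 := h1 1
      have g2 := h2 1
      rw [divPow_one] at g1 g2
      exact K.sub_mem (K.mul_mem g1 g2) (sgn_smul_mem _ _ (K.mul_mem g2 g1))
    · rw [divPow_odd_eq_zero h (by omega)]
      exact K.zero_mem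

theorem parity_eq_of_between {i k j : Fin (m + n)} (h1 : i ≤ k) (h2 : k ≤ j)
    (h : parity m n i = parity m n j) : parity m n k = parity m n i := by
  rw [Fin.le_def] at h1 h2
  simp only [parity] at h ⊢
  by_cases hi : i.val < m
  · by_cases hj : j.val < m
    · rw [if_pos hi, if_pos (by omega)]
    · rw [if_pos hi, if_neg hj] at h
      exact absurd h zero_ne_one
  · rw [if_neg hi, if_neg (by omega)]

theorem divPow_unitS_mem_of_val_eq (δ : ℕ) (i j : Fin (m + n)) (h : j.val = i.val + δ + 1) :
    (∀ r, divPow (unitS m n d i j) r ∈ kostantForm m n d) ∧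
      ∀ r, divPow (unitS m n d j i) r ∈ kostantForm m n d := by
  have base : ∀ i j : Fin (m + n), j.val = i.val + 1 →
      (∀ r, divPow (unitS m n d i j) r ∈ kostantForm m n d) ∧
        ∀ r, divPow (unitS m n d j i) r ∈ kostantForm m n d := fun i j h =>
    ⟨fun r => Subring.subset_closure (Or.inl ⟨i, j, r, h, Or.inl rfl⟩),
      fun r => Subring.subset_closure (Or.inl ⟨i, j, r, h, Or.inr rfl⟩)⟩
  induction δ generalizing j with
  | zero => exact base i j h
  | succ δ ih =>
    have hj := j.2
    let k : Fin (m + n) := ⟨i.val + δ + 1, by omega⟩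
    have hk : k.val = i.val + δ + 1 := rfl
    have hik : i ≠ k := by intro e; have := congrArg Fin.val e; omega
    have hij : i ≠ j := by intro e; have := congrArg Fin.val e; omega
    have hkj : k ≠ j := by intro e; have := congrArg Fin.val e; omega
    have hle1 : i ≤ k := by rw [Fin.le_def]; omega
    have hle2 : k ≤ j := by rw [Fin.le_def]; omega
    obtain ⟨a1, a2⟩ := ih k rfl
    obtain ⟨b1, b2⟩ := base k j (by omega)
    have hpar := parity_eq_of_between hle1 hle2
    exact ⟨divPow_unitS_mem_of hij hik hkj hpar a1 b1,
      divPow_unitS_mem_of hij.symm hkj.symm hik.symm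
        (fun e => (hpar e.symm).trans e.symm) b2 a2⟩

/-- All divided powers of root vectors lie in the Kostant form. -/
theorem divPow_unitS_mem {i j : Fin (m + n)} (hij : i ≠ j) (r : ℕ) :
    divPow (unitS m n d i j) r ∈ kostantForm m n d := by
  rcases lt_or_gt_of_ne hij with h | h
  · rw [Fin.lt_def] at h
    exact (divPow_unitS_mem_of_val_eq (j.val - i.val - 1) i j (by omega)).1 r
  · rw [Fin.lt_def] at h
    exact (divPow_unitS_mem_of_val_eq (i.val - j.val - 1) j i (by omega)).2 r

theorem eval_mem_kostantForm (M : KMonomial m n) : KMonomial.eval d M ∈ kostantForm m n d := by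
  refine Subring.list_prod_mem _ fun x hx => ?_
  obtain ⟨F, -, rfl⟩ := List.mem_map.1 hx
  cases F with
  | root α r => exact divPow_unitS_mem α.2 r
  | cartan i s => exact Subring.subset_closure (Or.inr ⟨i, s, rfl⟩)

theorem basisElt_mem_kostantForm (l : Label d ord) : basisElt ord l ∈ kostantForm m n d :=
  Subring.mul_mem _ (Subring.mul_mem _ (eval_mem_kostantForm _) (eval_mem_kostantForm _))
    (eval_mem_kostantForm _)

/-- Entries whose square is 0 or 1 are integers; the case left over is a power at least 2 of an odd
root vector, which is zero. -/
theorem toMat_divPow_mem_int {i j : Fin (m + n)} (hij : i ≠ j) (r : ℕ) (s t : Word m n d) :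
    toMat m n d (divPow (unitS m n d i j) r) s t ∈ (Int.castRingHom ℚ).range := by
  by_cases hr : parity m n i + parity m n j = 1 → r = 0 ∨ r = 1
  · have h := toMat_divPow_sq hij r hr s t
    split_ifs at h
    · rw [sq, mul_self_eq_one_iff] at h
      rcases h with h | h
      · rw [h]; exact Subring.one_mem _
      · rw [h]; exact Subring.neg_mem _ (Subring.one_mem _)
    · rw [sq_eq_zero_iff.1 h]
      exact Subring.zero_mem _
  · push Not at hr
    rw [divPow_odd_eq_zero hr.1 (by omega), map_zero]
    exact Subring.zero_mem _

/-- The elements of the Kostant form have integral matrix coefficients. -/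
theorem toMat_mem_int {x : Schur m n d} (hx : x ∈ kostantForm m n d) (s t : Word m n d) :
    toMat m n d x s t ∈ (Int.castRingHom ℚ).range := by
  induction hx using Subring.closure_induction generalizing s t with
  | mem x hx =>
    rcases hx with ⟨i, j, k, hij, rfl | rfl⟩ | ⟨i, k, rfl⟩
    · exact toMat_divPow_mem_int (by rintro rfl; omega) k s t
    · exact toMat_divPow_mem_int (by rintro rfl; omega) k s t
    · rw [toMat_cartan, Matrix.diagonal_apply]
      split_ifs
      · exact natCast_mem _ _
      · exact Subring.zero_mem _
  | zero => rw [map_zero]; exact Subring.zero_mem _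
  | one =>
    rw [map_one, Matrix.one_apply]
    split_ifs
    · exact Subring.one_mem _
    · exact Subring.zero_mem _
  | add x y _ _ hx hy => rw [map_add]; exact Subring.add_mem _ (hx s t) (hy s t)
  | neg x _ hx => rw [map_neg]; exact Subring.neg_mem _ (hx s t)
  | mul x y _ _ hx hy =>
    rw [map_mul, Matrix.mul_apply]
    exact Subring.sum_mem _ fun u _ => Subring.mul_mem _ (hx s u) (hy u t)

theorem linearIndependent_basisElt (hnodup : ord.Nodup) (hall : ∀ α, α ∈ ord) :
    LinearIndependent ℚ (basisElt (d := d) ord) :=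
  LinearIndependent.of_comp (toMat m n d).toLinearMap
    (linearIndependent_toMat_basisElt hnodup hall)

theorem exists_eq_sum_basisElt_rat [Fintype (Label d ord)] (hnodup : ord.Nodup)
    (hall : ∀ α, α ∈ ord) (x : Schur m n d) :
    ∃ c : Label d ord → ℚ, x = ∑ l, c l • basisElt ord l := by
  -- Taking all of ℚ as the coefficient group makes the membership conditions empty.
  obtain ⟨c, -, hc⟩ := exists_eq_sum_basisElt hnodup hall ⊤ (toMat_mem_invariants x)
    (fun _ _ => trivial) (fun _ _ _ _ _ => trivial)
  refine ⟨c, toMat_injective m n d ?_⟩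
  rw [hc, map_sum]
  simp only [map_smul]

theorem exists_eq_sum_basisElt_int [Fintype (Label d ord)] (hnodup : ord.Nodup)
    (hall : ∀ α, α ∈ ord) {x : Schur m n d} (hx : x ∈ kostantForm m n d) :
    ∃ c : Label d ord → ℤ, x = ∑ l, c l • basisElt ord l := by
  obtain ⟨c, hcZ, hc⟩ := exists_eq_sum_basisElt (ord := ord) hnodup hall
    (Int.castRingHom ℚ).range.toAddSubgroup (toMat_mem_invariants x)
    (fun s t => toMat_mem_int hx s t)
    (fun l s t c hc => Subring.mul_mem _ hc (toMat_mem_int (basisElt_mem_kostantForm l) s t))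
  choose z hz using hcZ
  refine ⟨z, toMat_injective m n d ?_⟩
  rw [hc, map_sum]
  refine Finset.sum_congr rfl fun l _ => ?_
  rw [map_zsmul, ← hz l, eq_intCast, Int.cast_smul_eq_zsmul]

end

end

end SchurSuper

open SchurSuper in
theorem theoremT (m n d : ℕ) (hd : 1 ≤ d)
    (ord : List (SchurSuper.PosRoot m n)) (hnodup : ord.Nodup) (hall : ∀ α, α ∈ ord) :
    Function.Injective (SchurSuper.basisElt (d := d) ord) ∧
    (∃ b : Module.Basis (SchurSuper.setY d ord) ℚ (SchurSuper.Schur m n d),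
      ∀ y, b y = (y : SchurSuper.Schur m n d)) ∧
    (∃ b : Module.Basis (SchurSuper.setY d ord) ℤ (SchurSuper.kostantForm m n d),
      ∀ y, (b y : SchurSuper.Schur m n d) = (y : SchurSuper.Schur m n d)) := by
  have := finite_label (d := d) hnodup hall
  have := Fintype.ofFinite (Label d ord)
  have hli := linearIndependent_basisElt (d := d) hnodup hall
  have hinj : Function.Injective (basisElt (d := d) ord) := hli.injective
  let e : Label d ord ≃ setY d ord := Equiv.ofInjective _ hinj
  have he : ∀ y, basisElt ord (e.symm y) = y := fun y =>
    congrArg Subtype.val (e.apply_symm_apply y)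
  refine ⟨hinj, ?_, ?_⟩
  · have hspan : ⊤ ≤ Submodule.span ℚ (Set.range (basisElt (d := d) ord)) := by
      intro x _
      obtain ⟨c, rfl⟩ := exists_eq_sum_basisElt_rat hnodup hall x
      exact Submodule.sum_mem _ fun l _ =>
        Submodule.smul_mem _ _ (Submodule.subset_span ⟨l, rfl⟩)
    refine ⟨(Module.Basis.mk hli hspan).reindex e, fun y => ?_⟩
    rw [Module.Basis.reindex_apply, Module.Basis.mk_apply, he]
  · let v : Label d ord → kostantForm m n d := fun l =>
      ⟨basisElt ord l, basisElt_mem_kostantForm l⟩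
    have hliZ : LinearIndependent ℤ v := by
      refine LinearIndependent.of_comp
        (kostantForm m n d).subtype.toAddMonoidHom.toIntLinearMap ?_
      -- Independence over ℤ is inherited from independence over ℚ in the ambient algebra.
      exact hli.restrict_scalars' ℤ
    have hspan : ⊤ ≤ Submodule.span ℤ (Set.range v) := by
      rintro ⟨x, hx⟩ _
      obtain ⟨c, hc⟩ := exists_eq_sum_basisElt_int (ord := ord) hnodup hall hx
      have : (⟨x, hx⟩ : kostantForm m n d) = ∑ l, c l • v l := by
        refine Subtype.ext (hc.trans ?_)
        simp [v]
      rw [this]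
      exact Submodule.sum_mem _ fun l _ =>
        Submodule.smul_mem _ _ (Submodule.subset_span ⟨l, rfl⟩)
    refine ⟨(Module.Basis.mk hliZ hspan).reindex e, fun y => ?_⟩
    rw [Module.Basis.reindex_apply, Module.Basis.mk_apply]
    exact he y
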